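/- All matroids are finite. A lattice path is a finite sequence of unit North and East steps in the integer grid. Let $P$ and $Q$ be lattice paths from $(0,0)$ to $(m,r)$ such that $P$ never goes above $Q$. The lattice path matroid $M[P,Q]$ has ground set $\{1,\dots,m+r\}$, and its bases are the sets of positions of the North steps of those lattice paths from $(0,0)$ to $(m,r)$ that stay in the region bounded by $P$ and $Q$; a matroid is lattice path if it is isomorphic to some $M[P,Q]$. Let $G$ be a finite multigraph whose edges may be links (two distinct ends), loops (both ends at the same vertex) or free edges (incident with no vertex). A bicircular graph is a subdivision of a $\theta$-graph (two vertices joined by three parallel links), of tight handcuffs (two loops at one vertex) or of loose handcuffs (a link with a loop at each of its ends). The bicircular matroid of $G$ is the matroid on $E(G)$ whose circuits are the singletons of free edges and the subsets of $E(G)$ that induce a bicircular graph; a matroid is bicircular if it is the bicircular matroid of some such $G$. A matroid $M$ is an excluded minor for the class of bicircular and lattice path matroids if $M$ is not both bicircular and lattice path, but every proper minor of $M$ is both bicircular and lattice path. Let $U_{r,n}$ be the rank-$r$ uniform matroid on $n$ elements. The truncation $T(N)$ of a matroid $N$ is obtained by adding an element $e$ freely to $N$ and then contracting $e$. For a matroid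 $N$ of rank $n+k$, $T_n(N)$ denotes the result of $k$ successive truncations of $N$. **Lemma.** Let $M$ be a rank-$3$ lattice path matroid. Then $M$ is an excluded minor for the class of bicircular and lattice path matroids if and only if $M$ is isomorphic to one of the matroids $U_{3,7}$, $T_3(U_{1,2}\oplus U_{3,5})$ and $T_3(U_{1,2}\oplus U_{1,2}\oplus U_{3,3})$. -/

import Mathlib

namespace BicircularLatticePath

/-! ### Isomorphism and excluded minors -/

/-- Two matroids are isomorphic if some bijection of their ground sets preserves
independence in both directions. -/
def IsIsoTo {α β : Type*} (M : Matroid α) (N : Matroid β) : Prop :=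
  ∃ e : M.E ≃ N.E, ∀ I : Set M.E,
    M.Indep (Subtype.val '' I) ↔ N.Indep (Subtype.val '' (e '' I))

/-- `M` is an excluded minor for the class `𝒞`: it is not in `𝒞`, but every proper minor is. -/
def IsExcludedMinor {α : Type*} (𝒞 : Matroid α → Prop) (M : Matroid α) : Prop :=
  ¬ 𝒞 M ∧ ∀ N : Matroid α, N.IsStrictMinor M → 𝒞 N

/-! ### Lattice path matroids -/

/-- A unit step in the grid. -/
inductive Step where
  | north
  | east

/-- A lattice path from the origin with `n` steps. -/
abbrev LatticePath (n : ℕ) := Fin n → Step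

/-- The set of (positions of) north steps of a path. -/
def LatticePath.norths {n : ℕ} (P : LatticePath n) : Set (Fin n) :=
  {i | P i = Step.north}

/-- The height (second coordinate) of a path after its first `k` steps. -/
noncomputable def LatticePath.height {n : ℕ} (P : LatticePath n) (k : ℕ) : ℕ :=
  {i ∈ P.norths | (i : ℕ) < k}.ncard

/-- `P` never goes above `Q`. After `k` steps both paths are on the same antidiagonal, so this
compares their heights there. -/
def LatticePath.Below {n : ℕ} (P Q : LatticePath n) : Prop :=
  ∀ k ≤ n, P.height k ≤ Q.height k

/-- `M` is (isomorphic to) a lattice path matroid `M[P, Q]`: here `P` and `Q` are lattice paths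
with the same two endpoints, `P` never goes above `Q`, the elements of `M` are labelled by the
positions of the steps, and the bases are the sets of north steps of the
lattice paths `R` with the same two endpoints that stay in the region bounded by `P` and `Q`. -/
def IsLatticePathMatroid {α : Type*} (M : Matroid α) : Prop :=
  ∃ (n : ℕ) (P Q : LatticePath n),
    P.height n = Q.height n ∧ P.Below Q ∧
    ∃ e : M.E ≃ Fin n, ∀ B : Set M.E,
      M.IsBase (Subtype.val '' B) ↔
        ∃ R : LatticePath n, R.height n = P.height n ∧ P.Below R ∧ R.Below Q ∧ e '' B = R.norths

/-! ### Bicircular matroids -/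

/-- A multigraph with vertex type `V` and edges indexed by `E`. An edge `e` is a link or a loop
when `ends e = some s(x, y)` (with `x ≠ y` or `x = y`, respectively), and it is a free edge,
meeting no vertex, when `ends e = none`. -/
structure FreeEdgeGraph (V E : Type*) where
  /-- The unordered pair of ends of an edge, if it has ends. -/
  ends : E → Option (Sym2 V)

/-- `IsBicircularEdgeSet G C`: the edges in `C`, together with their ends in `G`, form a
bicircular graph, that is, a subdivision of one of three graphs: three parallel links (a
theta graph), two loops at a vertex (tight handcuffs), or a link with a loop at each
end (loose handcuffs).

In the last constructor, `G` on `insert f C` is obtained from the bicircular graph `H` on `C` by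
subdividing the edge `e` of `H` with ends `x`, `y`: it is replaced by an edge from `x` to the new
vertex `w`, again named `e`, and a new edge `f` from `w` to `y`. -/
inductive IsBicircularEdgeSet {V E : Type*} : FreeEdgeGraph V E → Set E → Prop
  | theta (G : FreeEdgeGraph V E) (x y : V) (e f g : E) (hxy : x ≠ y)
      (hef : e ≠ f) (heg : e ≠ g) (hfg : f ≠ g)
      (he : G.ends e = some s(x, y)) (hf : G.ends f = some s(x, y))
      (hg : G.ends g = some s(x, y)) :
      IsBicircularEdgeSet G {e, f, g}
  | tightHandcuff (G : FreeEdgeGraph V E) (x : V) (e f : E) (hef : e ≠ f)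
      (he : G.ends e = some s(x, x)) (hf : G.ends f = some s(x, x)) :
      IsBicircularEdgeSet G {e, f}
  | looseHandcuff (G : FreeEdgeGraph V E) (x y : V) (e f g : E) (hxy : x ≠ y)
      (he : G.ends e = some s(x, x)) (hf : G.ends f = some s(x, y))
      (hg : G.ends g = some s(y, y)) :
      IsBicircularEdgeSet G {e, f, g}
  | subdivide (G H : FreeEdgeGraph V E) (C : Set E) (e f : E) (x y w : V)
      (hC : IsBicircularEdgeSet H C) (heC : e ∈ C) (hfC : f ∉ C)
      (hw : ∀ g ∈ C, ∀ p : Sym2 V, H.ends g = some p → w ∉ p)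
      (hHe : H.ends e = some s(x, y))
      (hGe : G.ends e = some s(x, w)) (hGf : G.ends f = some s(w, y))
      (hGH : ∀ g ∈ C, g ≠ e → G.ends g = H.ends g) :
      IsBicircularEdgeSet G (insert f C)

/-- `M` is the bicircular matroid of a finite graph `G` with edge set `M.E`: the circuits of `M`
are the singletons of free edges of `G` and the edge sets of bicircular subgraphs of `G`.
(The values of `G.ends` outside `M.E` play no role.) -/
def IsBicircularMatroid {α : Type*} (M : Matroid α) : Prop :=
  M.Finite ∧ ∃ (n : ℕ) (G : FreeEdgeGraph (Fin n) α), ∀ C ⊆ M.E,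
    M.IsCircuit C ↔ (∃ e, G.ends e = none ∧ C = {e}) ∨ IsBicircularEdgeSet G C

/-! ### Uniform matroids and truncation -/

/-- The uniform matroid `U_{r,n}` on `Fin n`: a set is independent iff it has at most `r`
elements. -/
def uniform (r n : ℕ) : Matroid (Fin n) :=
  (IndepMatroid.ofFinite (E := Set.univ) Set.finite_univ (fun I => I.ncard ≤ r)
    (by simp)
    (fun _ J hJ hIJ => (Set.ncard_le_ncard hIJ J.toFinite).trans hJ)
    (by
      intro I J _ hJ hIJ
      obtain ⟨e, heJ, heI⟩ := Set.exists_mem_notMem_of_ncard_lt_ncard hIJ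
      refine ⟨e, heJ, heI, ?_⟩
      rw [Set.ncard_insert_of_notMem heI]
      omega)
    (fun _ _ => Set.subset_univ _)).matroid

/-- A helper: in a finite matroid, an independent set smaller than another one is not a base. -/
theorem not_isBase_of_ncard_lt {α : Type*} [Finite α] {M : Matroid α} {I J : Set α}
    (hJ : M.Indep J) (h : I.ncard < J.ncard) : ¬ M.IsBase I := by
  intro hI
  obtain ⟨B, hB, hJB⟩ := hJ.exists_isBase_superset
  have h1 := hI.ncard_eq_ncard_of_isBase hB
  have h2 := Set.ncard_le_ncard hJB B.toFinite
  omega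

/-- A helper: in a finite matroid, an independent set that is not a base is smaller than any
base. -/
theorem ncard_lt_of_not_isBase {α : Type*} [Finite α] {M : Matroid α} {I B : Set α}
    (hI : M.Indep I) (hI' : ¬ M.IsBase I) (hB : M.IsBase B) : I.ncard < B.ncard := by
  obtain ⟨B', hB', hIB⟩ := hI.exists_isBase_superset
  rw [hB.ncard_eq_ncard_of_isBase hB']
  refine Set.ncard_lt_ncard (hIB.ssubset_of_ne ?_) B'.toFinite
  rintro rfl
  exact hI' hB'

theorem ncard_option {α : Type*} [Finite α] (I : Set (Option α)) :
    (none ∈ I → I.ncard = (some ⁻¹' I).ncard + 1) ∧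
      (none ∉ I → I.ncard = (some ⁻¹' I).ncard) := by
  have hi : (some '' (some ⁻¹' I)).ncard = (some ⁻¹' I).ncard :=
    Set.ncard_image_of_injective _ (Option.some_injective α)
  constructor
  · intro h
    rw [← hi, ← Set.ncard_insert_of_notMem (a := (none : Option α)) (by simp)]
    congr 1
    ext x
    cases x <;> simp [h]
  · intro h
    rw [← hi]
    congr 1
    ext x
    cases x <;> simp [h]

/-- The free extension `M + e` of a matroid `M` by a new element `e`, here `none`: the independent
sets are those of `M`, and the sets `I ∪ {e}` with `I` independent in `M` but not a base. -/
def freeExtension {α : Type*} [Finite α] (M : Matroid α) : Matroid (Option α) :=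
  (IndepMatroid.ofFinite (E := insert none (some '' M.E)) (Set.toFinite _)
    (fun I => M.Indep (some ⁻¹' I) ∧ (none ∈ I → ¬ M.IsBase (some ⁻¹' I)))
    (by simp)
    (by
      rintro I J ⟨hJ, hJ'⟩ hIJ
      have hsub : some ⁻¹' I ⊆ some ⁻¹' J := Set.preimage_mono hIJ
      refine ⟨hJ.subset hsub, fun hn hB => hJ' (hIJ hn) ?_⟩
      rwa [← hB.eq_of_subset_indep hJ hsub])
    (by
      rintro I J ⟨hI, hI'⟩ ⟨hJ, hJ'⟩ hIJ
      have cI := ncard_option I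
      have cJ := ncard_option J
      have key : ∀ x, x ∈ some ⁻¹' J → x ∉ some ⁻¹' I → M.Indep (insert x (some ⁻¹' I)) →
          (none ∈ I → ¬ M.IsBase (insert x (some ⁻¹' I))) →
          ∃ e ∈ J, e ∉ I ∧ M.Indep (some ⁻¹' insert e I) ∧
            (none ∈ insert e I → ¬ M.IsBase (some ⁻¹' insert e I)) := by
        intro x hxJ hxI hx hx'
        have heq : some ⁻¹' insert (some x) I = insert x (some ⁻¹' I) := by
          ext z; simp
        refine ⟨some x, hxJ, hxI, by rwa [heq], ?_⟩
        rw [heq]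
        intro hn
        exact hx' (by simpa using hn)
      have aug : (some ⁻¹' I).ncard < (some ⁻¹' J).ncard →
          ∃ x ∈ some ⁻¹' J, x ∉ some ⁻¹' I ∧ M.Indep (insert x (some ⁻¹' I)) := by
        intro hlt
        have hlt' : (some ⁻¹' I).encard < (some ⁻¹' J).encard := by
          rw [← (Set.toFinite (some ⁻¹' I)).cast_ncard_eq,
            ← (Set.toFinite (some ⁻¹' J)).cast_ncard_eq]
          exact_mod_cast hlt
        obtain ⟨x, hx, hx'⟩ := hI.augment hJ hlt'
        exact ⟨x, hx.1, hx.2, hx'⟩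
      by_cases hnI : none ∈ I
      · have h1 := cI.1 hnI
        have hlt : (some ⁻¹' I).ncard < (some ⁻¹' J).ncard := by
          by_cases hnJ : none ∈ J
          · have := cJ.1 hnJ; omega
          · have := cJ.2 hnJ; omega
        obtain ⟨x, hxJ, hxI, hx⟩ := aug hlt
        refine key x hxJ hxI hx fun _ => ?_
        have hc := Set.ncard_insert_of_notMem hxI
        by_cases hnJ : none ∈ J
        · obtain ⟨B, hB⟩ := M.exists_isBase
          have h2 := ncard_lt_of_not_isBase hJ (hJ' hnJ) hB
          exact not_isBase_of_ncard_lt hB.indep (by omega)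
        · have h3 := cJ.2 hnJ
          exact not_isBase_of_ncard_lt hJ (by omega)
      · have h1 := cI.2 hnI
        by_cases hlt : (some ⁻¹' I).ncard < (some ⁻¹' J).ncard
        · obtain ⟨x, hxJ, hxI, hx⟩ := aug hlt
          exact key x hxJ hxI hx fun h => absurd h hnI
        · have hnJ : none ∈ J := by
            by_contra hnJ
            have := cJ.2 hnJ
            omega
          have h2 := cJ.1 hnJ
          have heq : some ⁻¹' insert none I = some ⁻¹' I := by
            ext z; simp
          refine ⟨none, hnJ, hnI, by rwa [heq], fun _ => ?_⟩
          rw [heq]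
          obtain ⟨B, hB⟩ := M.exists_isBase
          have h3 := ncard_lt_of_not_isBase hJ (hJ' hnJ) hB
          exact not_isBase_of_ncard_lt hB.indep (by omega))
    (by
      rintro I ⟨hI, -⟩ x hx
      cases x with
      | none => simp
      | some x => exact Or.inr ⟨x, hI.subset_ground hx, rfl⟩)).matroid

/-- The truncation `T(M)`: contract `e` from the free extension `M + e`. The result lives on
`Option α` without `none`, and is carried back to `α` along `some`. -/
def truncation {α : Type*} [Finite α] (M : Matroid α) : Matroid α :=
  ((freeExtension M).contract {none}).comap some

/-- The truncation `T_n(M)` of a matroid of rank `n + k` to rank `n`: truncate `k` times. -/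
noncomputable def truncationTo {α : Type*} [Finite α] (n : ℕ) (M : Matroid α) : Matroid α :=
  truncation^[M.eRank.toNat - n] M

end BicircularLatticePath

open BicircularLatticePath

/-!
A bicircular matroid is a transversal matroid: a set of edges is independent exactly if its
edges have distinct representatives among their ends (`indep_iff_matchable`), so every element has
at most two possible representatives. Conversely, a transversal presentation by sets with at
most two members is a graph (`IsPresentation.isBicircularMatroid`). The graph-theoretic core is
that a minimal edge set without distinct representatives has one edge more than it has vertices, and
is therefore a subdivided theta graph or handcuff (`isBicircularEdgeSet_of_card`).

A lattice path matroid of rank `r` is transversal as well: each element can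
be the north step number `v` of a path exactly for the `v` in an interval
(`IsLatticePathMatroid.exists_isPresentation`). In rank at most three it is bicircular if no
element has all of `{0, 1, 2}` as its interval. Otherwise the nonempty intervals are `{0}`, `{0, 1}`, `{0, 1, 2}`, `{1, 2}`, `{2}`, all of them occur, and
the numbers of elements with `{0}`, `{0, 1, 2}` and `{2}` are decisive: either the presentation
can be replaced by one with at most two representatives for each element, or there are seven
elements whose restriction is one of the three matroids
(`IsLatticePathMatroid.isBicircularMatroid_or_exists_isIsoTo`).

The three matroids are the rank-three uniform matroids on seven, six and five elements with
none, one and two elements doubled. None of them is bicircular: in a graph on three vertices each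
of the seven edges misses a vertex, and the pigeonhole principle gives three independent edges on only two
vertices (`IsDoubledUniform.not_isBicircularMatroid`). Their proper minors are lattice path
matroids (`IsLatticePathMatroid.of_isMinor`) with fewer than seven elements, hence bicircular.
-/

namespace BicircularLatticePath

/-! ### Distinct representatives in bicircular graphs -/

/-- `I` can be matched into the family of sets `A`: some system of distinct representatives
`φ e ∈ A e`, for `e ∈ I`. Since `φ` is defined on all of `α`, even `I = ∅` is matchable only
if `V` is nonempty (or `α` is empty). -/
def Matchable {α V : Type*} (A : α → Set V) (I : Set α) : Prop :=
  ∃ φ : α → V, Set.InjOn φ I ∧ ∀ e ∈ I, φ e ∈ A e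

theorem Matchable.mono {α V : Type*} {A : α → Set V} {I J : Set α} (hJ : Matchable A J)
    (h : I ⊆ J) : Matchable A I := by
  obtain ⟨φ, h1, h2⟩ := hJ
  exact ⟨φ, h1.mono h, fun e he => h2 e (h he)⟩

theorem injOn_update_insert {α V : Type*} [DecidableEq α] {I : Set α} {φ : α → V}
    (h1 : Set.InjOn φ I) {f : α} {v : V} (hf : f ∉ I) (hφ : ∀ e ∈ I, φ e ≠ v) :
    Set.InjOn (Function.update φ f v) (insert f I) := by
  have hne : ∀ e ∈ I, e ≠ f := fun e he h => hf (h ▸ he)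
  rw [Set.injOn_insert hf]
  refine ⟨fun a ha b hb hab => ?_, ?_⟩
  · rw [Function.update_of_ne (hne a ha), Function.update_of_ne (hne b hb)] at hab
    exact h1 ha hb hab
  · rintro ⟨a, ha, hab⟩
    rw [Function.update_of_ne (hne a ha), Function.update_self] at hab
    exact hφ a ha hab

theorem update_mem_insert {α V : Type*} [DecidableEq α] {A : α → Set V} {I : Set α} {φ : α → V}
    (h2 : ∀ e ∈ I, φ e ∈ A e) {f : α} {v : V} (hf : f ∉ I) (hv : v ∈ A f) :
    ∀ e ∈ insert f I, Function.update φ f v e ∈ A e := by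
  rintro e (rfl | he)
  · rwa [Function.update_self]
  · rw [Function.update_of_ne (show e ≠ f by rintro rfl; exact hf he)]
    exact h2 e he

theorem Matchable.insert {α V : Type*} {A : α → Set V} {I : Set α} {φ : α → V}
    (h1 : Set.InjOn φ I) (h2 : ∀ e ∈ I, φ e ∈ A e) {f : α} {v : V} (hf : f ∉ I)
    (hv : v ∈ A f) (hφ : ∀ e ∈ I, φ e ≠ v) : Matchable A (insert f I) := by
  classical
  exact ⟨Function.update φ f v, injOn_update_insert h1 hf hφ, update_mem_insert h2 hf hv⟩

theorem Matchable.ncard_le {α V : Type*} {A : α → Set V} {I : Set α} (hI : Matchable A I)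
    (W : Finset V) (h : ∀ e ∈ I, A e ⊆ W) : I.ncard ≤ W.card := by
  obtain ⟨φ, h1, h2⟩ := hI
  rw [← Set.ncard_coe_finset]
  exact Set.ncard_le_ncard_of_injOn φ (fun e he => h e he (h2 e he)) h1 W.finite_toSet

/-- The set of ends of an edge, empty for a free edge. -/
def FreeEdgeGraph.endSet {V E : Type*} (G : FreeEdgeGraph V E) (e : E) : Set V :=
  {v | ∃ p, G.ends e = some p ∧ v ∈ p}

theorem FreeEdgeGraph.endSet_of_eq {V E : Type*} {G : FreeEdgeGraph V E} {e : E} {x y : V}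
    (h : G.ends e = some s(x, y)) : G.endSet e = {x, y} := by
  ext v
  simp [FreeEdgeGraph.endSet, h]

theorem FreeEdgeGraph.endSet_congr {V E : Type*} {G H : FreeEdgeGraph V E} {e : E}
    (h : G.ends e = H.ends e) : G.endSet e = H.endSet e := by
  simp [FreeEdgeGraph.endSet, h]

/-- A bicircular graph has fewer vertices than edges. -/
theorem IsBicircularEdgeSet.exists_card_lt {V E : Type*} {G : FreeEdgeGraph V E} {C : Set E}
    (h : IsBicircularEdgeSet G C) :
    C.Finite ∧ ∃ W : Finset V, W.card < C.ncard ∧ ∀ e ∈ C, G.endSet e ⊆ W := by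
  classical
  induction h with
  | theta G x y e f g hxy hef heg hfg he hf hg =>
    refine ⟨by simp, {x, y}, ?_, ?_⟩
    · rw [Set.ncard_eq_three.2 ⟨e, f, g, hef, heg, hfg, rfl⟩]
      exact Finset.card_le_two.trans_lt (by norm_num)
    · simp [G.endSet_of_eq he, G.endSet_of_eq hf, G.endSet_of_eq hg]
  | tightHandcuff G x e f hef he hf =>
    refine ⟨by simp, {x}, ?_, ?_⟩
    · rw [Set.ncard_pair hef]
      simp
    · simp [G.endSet_of_eq he, G.endSet_of_eq hf]
  | looseHandcuff G x y e f g hxy he hf hg =>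
    have hef : e ≠ f := by
      rintro rfl
      simp [he] at hf
      exact hxy hf
    have heg : e ≠ g := by
      rintro rfl
      simp [he] at hg
      exact hxy hg
    have hfg : f ≠ g := by
      rintro rfl
      simp [hf] at hg
      exact hxy hg
    refine ⟨by simp, {x, y}, ?_, ?_⟩
    · rw [Set.ncard_eq_three.2 ⟨e, f, g, hef, heg, hfg, rfl⟩]
      exact Finset.card_le_two.trans_lt (by norm_num)
    · simp [G.endSet_of_eq he, G.endSet_of_eq hf, G.endSet_of_eq hg]
  | subdivide G H C e f x y w hC heC hfC hw hHe hGe hGf hGH ih =>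
    obtain ⟨hfin, W, hW, hends⟩ := ih
    refine ⟨hfin.insert f, insert w W, ?_, ?_⟩
    · rw [Set.ncard_insert_of_notMem hfC hfin]
      exact (Finset.card_insert_le _ _).trans_lt (by omega)
    · have hxy := hends e heC
      rw [H.endSet_of_eq hHe, Set.insert_subset_iff, Set.singleton_subset_iff] at hxy
      rintro g (rfl | hg)
      · rw [G.endSet_of_eq hGf]
        simp [Set.insert_subset_iff, hxy.2]
      · by_cases hge : g = e
        · subst hge
          rw [G.endSet_of_eq hGe]
          simp [Set.insert_subset_iff, hxy.1]
        · rw [G.endSet_congr (hGH g hg hge)]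
          exact (hends g hg).trans (by simp)

/-- Deleting any edge from a bicircular graph leaves a graph whose edges have distinct
representatives among their ends. -/
theorem IsBicircularEdgeSet.matchable_diff {V E : Type*} {G : FreeEdgeGraph V E} {C : Set E}
    (h : IsBicircularEdgeSet G C) : ∀ e ∈ C, Matchable G.endSet (C \ {e}) := by
  classical
  have pair : ∀ (G : FreeEdgeGraph V E) (a b : E) (x y : V), x ≠ y → x ∈ G.endSet a →
      y ∈ G.endSet b → Matchable G.endSet {a, b} := by
    intro G a b x y hxy ha hb
    by_cases hab : a = b
    · subst hab
      exact ⟨fun _ => x, by simp, by simp [ha]⟩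
    · exact Matchable.insert (φ := fun _ => y) (I := {b}) (by simp) (by simp [hb]) (by simpa)
        ha (by simp [hxy.symm])
  induction h with
  | theta G x y e f g hxy hef heg hfg he hf hg =>
    have he' : G.endSet e = {x, y} := G.endSet_of_eq he
    have hf' : G.endSet f = {x, y} := G.endSet_of_eq hf
    have hg' : G.endSet g = {x, y} := G.endSet_of_eq hg
    rintro a (rfl | rfl | rfl)
    · exact (pair G f g x y hxy (by simp [hf']) (by simp [hg'])).mono (by
        rintro b ⟨rfl | rfl | rfl, hb⟩ <;> first | exact absurd rfl hb | simp)
    · exact (pair G e g x y hxy (by simp [he']) (by simp [hg'])).mono (by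
        rintro b ⟨rfl | rfl | rfl, hb⟩ <;> first | exact absurd rfl hb | simp)
    · exact (pair G e f x y hxy (by simp [he']) (by simp [hf'])).mono (by
        rintro b ⟨rfl | rfl | rfl, hb⟩ <;> first | exact absurd rfl hb | simp)
  | tightHandcuff G x e f hef he hf =>
    have he' : G.endSet e = {x, x} := G.endSet_of_eq he
    have hf' : G.endSet f = {x, x} := G.endSet_of_eq hf
    intro a ha
    refine ⟨fun _ => x, ?_, ?_⟩
    · rintro b ⟨rfl | rfl, hb⟩ c ⟨rfl | rfl, hc⟩ _ <;>
        rcases ha with rfl | rfl <;> first | rfl | exact absurd rfl hb | exact absurd rfl hc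
    · rintro b ⟨rfl | rfl, hb⟩ <;> simp [he', hf']
  | looseHandcuff G x y e f g hxy he hf hg =>
    have he' : G.endSet e = {x, x} := G.endSet_of_eq he
    have hf' : G.endSet f = {x, y} := G.endSet_of_eq hf
    have hg' : G.endSet g = {y, y} := G.endSet_of_eq hg
    rintro a (rfl | rfl | rfl)
    · exact (pair G f g x y hxy (by simp [hf']) (by simp [hg'])).mono (by
        rintro b ⟨rfl | rfl | rfl, hb⟩ <;> first | exact absurd rfl hb | simp)
    · exact (pair G e g x y hxy (by simp [he']) (by simp [hg'])).mono (by
        rintro b ⟨rfl | rfl | rfl, hb⟩ <;> first | exact absurd rfl hb | simp)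
    · exact (pair G e f x y hxy (by simp [he']) (by simp [hf'])).mono (by
        rintro b ⟨rfl | rfl | rfl, hb⟩ <;> first | exact absurd rfl hb | simp)
  | subdivide G H C e f x y w hC heC hfC hw hHe hGe hGf hGH ih =>
    have heH : H.endSet e = {x, y} := H.endSet_of_eq hHe
    have heG : G.endSet e = {x, w} := G.endSet_of_eq hGe
    have hfG : G.endSet f = {w, y} := G.endSet_of_eq hGf
    have hGH' : ∀ g ∈ C, g ≠ e → G.endSet g = H.endSet g :=
      fun g hg hge => G.endSet_congr (hGH g hg hge)
    have hw' : ∀ g ∈ C, ∀ v ∈ H.endSet g, v ≠ w := by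
      rintro g hg v ⟨p, hp, hv⟩ rfl
      exact hw g hg p hp hv
    have hef : e ≠ f := fun h => hfC (h ▸ heC)
    -- if `e` or `f` is deleted, then the other one is represented by the new vertex `w`
    obtain ⟨φ, h1, h2⟩ := ih e heC
    have h2G : ∀ g ∈ C \ {e}, φ g ∈ G.endSet g := fun g hg => by
      rw [hGH' g hg.1 hg.2]; exact h2 g hg
    have h2w : ∀ g ∈ C \ {e}, φ g ≠ w := fun g hg => hw' g hg.1 _ (h2 g hg)
    rintro g (rfl | hg)
    · refine (Matchable.insert h1 h2G (f := e) (v := w) (by simp) (by simp [heG]) h2w).mono ?_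
      rintro a ⟨rfl | ha, hag⟩
      · exact absurd rfl hag
      · by_cases hae : a = e
        · exact Or.inl hae
        · exact Or.inr ⟨ha, hae⟩
    · by_cases hge : g = e
      · subst hge
        refine (Matchable.insert h1 h2G (f := f) (v := w) (by simp [hfC]) (by simp [hfG])
          h2w).mono ?_
        rintro a ⟨rfl | ha, hag⟩
        · exact Or.inl rfl
        · exact Or.inr ⟨ha, hag⟩
      · -- the edge `e` of `H` is represented by `x` or by `y`; this end represents the half `a` of
        -- the subdivided edge that contains it, and `w` represents the other half `b`
        obtain ⟨ψ, k1, k2⟩ := ih g hg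
        have key : ∀ a b : E, ({a, b} : Set E) = {e, f} → a ≠ b → ψ e ∈ G.endSet a →
            w ∈ G.endSet b → Matchable G.endSet (insert f C \ {g}) := by
          intro a b hab hne ha hb
          have hnot : ∀ c ∈ ({a, b} : Set E), c ∉ (C \ {g}) \ {e} := by
            rw [hab]
            rintro c (rfl | rfl) <;> simp [hfC]
          have heg : e ∈ C \ {g} := ⟨heC, fun h => hge h.symm⟩
          have hJ : ∀ c ∈ (C \ {g}) \ {e}, ψ c ∈ G.endSet c := fun c hc => by
            rw [hGH' c hc.1.1 hc.2]
            exact k2 c hc.1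
          have ha' := hnot a (Or.inl rfl)
          have hb' := hnot b (Or.inr rfl)
          have : Matchable G.endSet (insert b (insert a ((C \ {g}) \ {e}))) := by
            refine Matchable.insert (φ := Function.update ψ a (ψ e)) (v := w)
              (injOn_update_insert (k1.mono Set.sdiff_subset) ha' fun c hc h =>
                hc.2 (k1 hc.1 heg h)) (update_mem_insert hJ ha' ha) ?_ hb ?_
            · rintro (h | h)
              · exact hne h.symm
              · exact hb' h
            · rintro c (rfl | hc)
              · rw [Function.update_self]
                exact hw' e heC _ (k2 e heg)
              · rw [Function.update_of_ne (show c ≠ a by rintro rfl; exact ha' hc)]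
                exact hw' c hc.1.1 _ (k2 c hc.1)
          refine this.mono ?_
          rintro c ⟨hc, hcg⟩
          by_cases hcef : c ∈ ({e, f} : Set E)
          · rw [← hab] at hcef
            rcases hcef with h | h
            · exact Or.inr (Or.inl h)
            · exact Or.inl h
          · simp only [Set.mem_insert_iff, Set.mem_singleton_iff, not_or] at hcef
            rcases hc with h | h
            · exact absurd h hcef.2
            · exact Or.inr (Or.inr ⟨⟨h, hcg⟩, hcef.1⟩)
        have := k2 e ⟨heC, fun h => hge h.symm⟩
        rw [heH] at this
        rcases this with h | h
        · exact key e f rfl hef (by simp [h, heG]) (by simp [hfG])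
        · exact key f e (Set.pair_comm _ _) hef.symm (by simp_all) (by simp [heG])

theorem IsBicircularEdgeSet.not_matchable {V E : Type*} {G : FreeEdgeGraph V E} {C : Set E}
    (h : IsBicircularEdgeSet G C) : ¬ Matchable G.endSet C := by
  obtain ⟨-, W, hW, hends⟩ := h.exists_card_lt
  intro hC
  exact absurd (hC.ncard_le W hends) (by omega)

/-! ### Minimal edge sets without distinct representatives -/

/-- The number of edge-ends of `e` at the vertex `v` (two for a loop at `v`). -/
noncomputable def FreeEdgeGraph.mult {V E : Type*} (G : FreeEdgeGraph V E) (v : V) (e : E) : ℕ :=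
  open Classical in
  (if v ∈ G.endSet e then 1 else 0) + (if G.ends e = some s(v, v) then 1 else 0)

theorem FreeEdgeGraph.sum_mult {V E : Type*} {G : FreeEdgeGraph V E} {e : E} {W : Finset V}
    (he : G.ends e ≠ none) (hW : G.endSet e ⊆ W) : ∑ v ∈ W, G.mult v e = 2 := by
  classical
  obtain ⟨p, hp⟩ := Option.ne_none_iff_exists'.1 he
  induction p using Sym2.ind with
  | _ x y =>
    rw [G.endSet_of_eq hp, Set.insert_subset_iff, Set.singleton_subset_iff] at hW
    have : ∀ v ∈ W, G.mult v e = (if v = x then 1 else 0) + (if v = y then 1 else 0) := by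
      intro v _
      simp only [FreeEdgeGraph.mult, G.endSet_of_eq hp, hp, Set.mem_insert_iff,
        Set.mem_singleton_iff, Option.some.injEq, Sym2.eq_iff]
      by_cases h1 : v = x <;> by_cases h2 : v = y <;> simp_all [eq_comm]
    rw [Finset.sum_congr rfl this, Finset.sum_add_distrib, Finset.sum_ite_eq', Finset.sum_ite_eq',
      if_pos (by exact_mod_cast hW.1), if_pos (by exact_mod_cast hW.2)]

/-- A graph with one more edge than vertices, in which every proper subset of the edges
meets at least as many vertices as it has edges, is bicircular. If some vertex
meets only two edge-ends, then it subdivides an edge of a smaller such graph; otherwise, counting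
edge-ends shows that there are at most two vertices. -/
theorem isBicircularEdgeSet_of_card {V E : Type*} [DecidableEq E] (n : ℕ) :
    ∀ (G : FreeEdgeGraph V E) (C : Finset E) (W : Finset V), W.card = n → C.card = n + 1 →
      (∀ e ∈ C, G.ends e ≠ none) → (∀ e ∈ C, G.endSet e ⊆ W) →
      (∀ J ⊂ C, ∀ U : Finset V, (∀ e ∈ J, G.endSet e ⊆ U) → J.card ≤ U.card) →
      IsBicircularEdgeSet G (C : Set E) := by
  classical
  induction n with
  | zero =>
    intro G C W hW hC hne hends _
    obtain ⟨e, rfl⟩ := Finset.card_eq_one.1 hC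
    obtain rfl := Finset.card_eq_zero.1 hW
    obtain ⟨p, hp⟩ := Option.ne_none_iff_exists'.1 (hne e (by simp))
    induction p using Sym2.ind with
    | _ x y =>
      have := hends e (by simp)
      rw [G.endSet_of_eq hp] at this
      simpa using this (Set.mem_insert _ _)
  | succ n ih =>
    intro G C W hW hC hne hends hJ
    by_cases hdeg : ∃ w ∈ W, ∑ e ∈ C, G.mult w e ≤ 2
    · -- the edges at `w` are two links, the halves of a subdivided edge
      obtain ⟨w, hwW, hdeg⟩ := hdeg
      set D := C.filter (fun e => w ∈ G.endSet e) with hD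
      -- if at most one edge `e` met `w`, then `C.erase e` would meet too few vertices
      have hD2 : 1 < D.card := by
        by_contra hlt
        obtain ⟨e, heC, heD⟩ : ∃ e ∈ C, D ⊆ {e} := by
          rcases D.eq_empty_or_nonempty with h | ⟨e, he⟩
          · obtain ⟨e, he⟩ := Finset.card_pos.1 (show 0 < C.card by omega)
            exact ⟨e, he, by simp [h]⟩
          · refine ⟨e, (Finset.mem_filter.1 he).1, fun f hf => ?_⟩
            exact Finset.mem_singleton.2 (Finset.card_le_one.1 (by omega) f hf e he)
        have := hJ (C.erase e) (Finset.erase_ssubset heC) (W.erase w) (by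
          intro f hf v hv
          have hf' := Finset.mem_erase.1 hf
          refine Finset.mem_coe.2 (Finset.mem_erase.2 ⟨?_, hends f hf'.2 hv⟩)
          rintro rfl
          exact hf'.1 (Finset.mem_singleton.1 (heD (Finset.mem_filter.2 ⟨hf'.2, hv⟩))))
        rw [Finset.card_erase_of_mem heC, Finset.card_erase_of_mem hwW] at this
        omega
      have hsum : ∑ e ∈ D, (1 + if G.ends e = some s(w, w) then 1 else 0) ≤ 2 := by
        refine le_trans ?_ hdeg
        rw [hD, Finset.sum_filter]
        refine Finset.sum_le_sum fun e _ => ?_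
        by_cases h : w ∈ G.endSet e <;> simp [FreeEdgeGraph.mult, h]
      rw [Finset.sum_add_distrib, Finset.sum_const, smul_eq_mul, mul_one] at hsum
      have hloop : ∀ e ∈ D, G.ends e ≠ some s(w, w) := by
        intro e he h
        have h0 : ∑ e ∈ D, (if G.ends e = some s(w, w) then 1 else 0) = 0 := by omega
        have := Finset.sum_eq_zero_iff.1 h0 e he
        simp [h] at this
      obtain ⟨e, f, hef, hDef⟩ := Finset.card_eq_two.1 (show D.card = 2 by omega)
      have link : ∀ g ∈ D, ∃ x, x ≠ w ∧ G.ends g = some s(x, w) := by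
        intro g hg
        obtain ⟨p, hp, hwp⟩ := (Finset.mem_filter.1 hg).2
        obtain ⟨x, rfl⟩ := Sym2.mem_iff_exists.1 hwp
        refine ⟨x, ?_, by rw [hp, Sym2.eq_swap]⟩
        rintro rfl
        exact hloop g hg hp
      have heD : e ∈ D := by simp [hDef]
      have hfD : f ∈ D := by simp [hDef]
      have heC := (Finset.mem_filter.1 heD).1
      have hfC := (Finset.mem_filter.1 hfD).1
      obtain ⟨x, hxw, hGe⟩ := link e heD
      obtain ⟨y, hyw, hGf⟩ := link f hfD
      have hnot : ∀ g ∈ C, g ≠ e → g ≠ f → w ∉ G.endSet g := by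
        intro g hg hge hgf h
        have : g ∈ D := Finset.mem_filter.2 ⟨hg, h⟩
        simp [hDef, hge, hgf] at this
      -- `H` undoes the subdivision
      let H : FreeEdgeGraph V E := ⟨Function.update G.ends e (some s(x, y))⟩
      have hHe : H.ends e = some s(x, y) := Function.update_self ..
      have hHg : ∀ g, g ≠ e → H.ends g = G.ends g := fun g hg => Function.update_of_ne hg ..
      have hxW : x ∈ W := by
        have := hends e heC
        rw [G.endSet_of_eq hGe] at this
        exact this (by simp)
      have hyW : y ∈ W := by
        have := hends f hfC
        rw [G.endSet_of_eq hGf] at this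
        exact this (by simp)
      have hwH : ∀ g ∈ C.erase f, w ∉ H.endSet g := by
        intro g hg h
        obtain ⟨hgf, hgC⟩ := Finset.mem_erase.1 hg
        by_cases hge : g = e
        · subst hge
          rw [H.endSet_of_eq hHe] at h
          rcases h with h | h
          · exact hxw h.symm
          · exact hyw h.symm
        · rw [FreeEdgeGraph.endSet_congr (hHg g hge)] at h
          exact hnot g hgC hge hgf h
      have hC' : IsBicircularEdgeSet H ((C.erase f : Finset E) : Set E) := by
        refine ih H (C.erase f) (W.erase w) ?_ ?_ ?_ ?_ ?_
        · rw [Finset.card_erase_of_mem hwW]; omega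
        · rw [Finset.card_erase_of_mem hfC]; omega
        · intro g hg
          by_cases hge : g = e
          · subst hge; simp [hHe]
          · rw [hHg g hge]; exact hne g (Finset.mem_of_mem_erase hg)
        · intro g hg v hv
          refine Finset.mem_coe.2 (Finset.mem_erase.2 ⟨fun h => hwH g hg (h ▸ hv), ?_⟩)
          by_cases hge : g = e
          · subst hge
            rw [H.endSet_of_eq hHe] at hv
            rcases hv with rfl | rfl
            · exact hxW
            · exact hyW
          · rw [FreeEdgeGraph.endSet_congr (hHg g hge)] at hv
            exact hends g (Finset.mem_of_mem_erase hg) hv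
        · intro J hJC U hU
          have hfJ : f ∉ J := fun h => by simpa using hJC.1 h
          by_cases heJ : e ∈ J
          · -- the edges `insert f J` of `G` meet the vertices that `J` meets in `H`, and `w`
            have h1 := hJ (insert f J) ?_ (insert w U) ?_
            · rw [Finset.card_insert_of_notMem hfJ] at h1
              have := Finset.card_insert_le w U
              omega
            · refine Finset.ssubset_iff_subset_ne.2 ⟨?_, ?_⟩
              · rw [Finset.insert_subset_iff]
                exact ⟨hfC, hJC.1.trans (Finset.erase_subset _ _)⟩
              · rintro rfl
                apply hJC.2
                rw [Finset.erase_insert hfJ]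
            · have hxy := hU e heJ
              rw [H.endSet_of_eq hHe, Set.insert_subset_iff, Set.singleton_subset_iff] at hxy
              intro g hg
              rcases Finset.mem_insert.1 hg with rfl | hg
              · rw [G.endSet_of_eq hGf]
                simp [Set.insert_subset_iff, Finset.mem_coe.1 hxy.2]
              · by_cases hge : g = e
                · subst hge
                  rw [G.endSet_of_eq hGe]
                  simp [Set.insert_subset_iff, Finset.mem_coe.1 hxy.1]
                · rw [← FreeEdgeGraph.endSet_congr (hHg g hge)]
                  exact (hU g hg).trans (by simp)
          · refine hJ J (hJC.trans_subset (Finset.erase_subset _ _)) U fun g hg => ?_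
            rw [← FreeEdgeGraph.endSet_congr (hHg g (fun h => heJ (h ▸ hg)))]
            exact hU g hg
      have := IsBicircularEdgeSet.subdivide G H _ e f x y w hC' (by simp [hef, heC]) (by simp)
        (fun g hg p hp hwp => hwH g hg ⟨p, hp, hwp⟩) hHe hGe (by rw [hGf, Sym2.eq_swap])
        (fun g _ hge => (hHg g hge).symm)
      rwa [← Finset.coe_insert, Finset.insert_erase hfC] at this
    · -- `3 * (n + 1) ≤ 2 * (n + 2)`, hence `n ≤ 1`
      push Not at hdeg
      have hcount : ∑ w ∈ W, ∑ e ∈ C, G.mult w e = 2 * C.card := by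
        rw [Finset.sum_comm, Finset.sum_congr rfl fun e he =>
          FreeEdgeGraph.sum_mult (hne e he) (hends e he)]
        simp [mul_comm]
      have hle : W.card * 3 ≤ ∑ w ∈ W, ∑ e ∈ C, G.mult w e := by
        rw [← smul_eq_mul, ← Finset.sum_const]
        exact Finset.sum_le_sum fun w hw => hdeg w hw
      have hn : n = 0 ∨ n = 1 := by omega
      rcases hn with rfl | rfl
      · obtain ⟨x, rfl⟩ := Finset.card_eq_one.1 hW
        obtain ⟨e, f, hef, rfl⟩ := Finset.card_eq_two.1 hC
        have loop : ∀ g ∈ ({e, f} : Finset E), G.ends g = some s(x, x) := by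
          intro g hg
          obtain ⟨p, hp⟩ := Option.ne_none_iff_exists'.1 (hne g hg)
          induction p using Sym2.ind with
          | _ u v =>
            have := hends g hg
            rw [G.endSet_of_eq hp] at this
            simp at this
            rw [hp, this.1, this.2]
        rw [Finset.coe_pair]
        exact .tightHandcuff G x e f hef (loop e (by simp)) (loop f (by simp))
      · obtain ⟨x, y, hxy, rfl⟩ := Finset.card_eq_two.1 hW
        have kind : ∀ g ∈ C, G.ends g = some s(x, x) ∧ G.mult x g = 2 ∧ G.mult y g = 0 ∨
            G.ends g = some s(x, y) ∧ G.mult x g = 1 ∧ G.mult y g = 1 ∨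
            G.ends g = some s(y, y) ∧ G.mult x g = 0 ∧ G.mult y g = 2 := by
          intro g hg
          have hg' : G.ends g = some s(x, x) ∨ G.ends g = some s(x, y) ∨
              G.ends g = some s(y, y) := by
            obtain ⟨p, hp⟩ := Option.ne_none_iff_exists'.1 (hne g hg)
            induction p using Sym2.ind with
            | _ u v =>
              have := hends g hg
              rw [G.endSet_of_eq hp] at this
              simp only [Finset.coe_insert, Finset.coe_singleton, Set.pair_subset_iff,
                Set.mem_insert_iff, Set.mem_singleton_iff] at this
              rw [hp]
              rcases this with ⟨rfl | rfl, rfl | rfl⟩ <;> simp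
          rcases hg' with h | h | h <;>
            simp [FreeEdgeGraph.mult, G.endSet_of_eq h, h, hxy, hxy.symm]
        have loops : ∀ z, ∀ g ∈ C, ∀ h ∈ C, g ≠ h → G.ends g = some s(z, z) →
            G.ends h ≠ some s(z, z) := by
          intro z g hg h hh hgh hgz hhz
          have := hJ {g, h} ?_ {z} ?_
          · rw [Finset.card_pair hgh] at this
            simp at this
          · refine Finset.ssubset_iff_subset_ne.2 ⟨by simp [Finset.insert_subset_iff, hg, hh], ?_⟩
            rintro rfl
            rw [Finset.card_pair hgh] at hC
            omega
          · simp [G.endSet_of_eq hgz, G.endSet_of_eq hhz]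
        have d1 := hdeg x (by simp)
        have d2 := hdeg y (by simp)
        obtain ⟨e, f, g, hef, heg, hfg, rfl⟩ := Finset.card_eq_three.1 hC
        have hsum : ∀ F : E → ℕ, ∑ a ∈ ({e, f, g} : Finset E), F a = F e + F f + F g := by
          intro F
          rw [Finset.sum_insert (by simp [hef, heg]), Finset.sum_pair hfg, add_assoc]
        rw [hsum] at d1 d2
        have l1 := fun z => loops z e (by simp) f (by simp) hef
        have l2 := fun z => loops z e (by simp) g (by simp) heg
        have l3 := fun z => loops z f (by simp) g (by simp) hfg
        rw [Finset.coe_insert, Finset.coe_pair]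
        have p1 : ({e, f, g} : Set E) = {e, g, f} := by rw [Set.pair_comm f g]
        have p2 : ({e, f, g} : Set E) = {f, e, g} := Set.insert_comm ..
        have p3 : ({e, f, g} : Set E) = {f, g, e} := by rw [p2, Set.pair_comm e g]
        have p4 : ({e, f, g} : Set E) = {g, e, f} := by rw [p1, Set.insert_comm]
        have p5 : ({e, f, g} : Set E) = {g, f, e} := by rw [p4, Set.pair_comm e f]
        rcases kind e (by simp) with ⟨he, e1, e2⟩ | ⟨he, e1, e2⟩ | ⟨he, e1, e2⟩ <;>
          rcases kind f (by simp) with ⟨hf, f1, f2⟩ | ⟨hf, f1, f2⟩ | ⟨hf, f1, f2⟩ <;>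
          rcases kind g (by simp) with ⟨hg, g1, g2⟩ | ⟨hg, g1, g2⟩ | ⟨hg, g1, g2⟩ <;>
          first
          | exact absurd hf (l1 _ he)
          | exact absurd hg (l2 _ he)
          | exact absurd hg (l3 _ hf)
          | exact .theta G x y e f g hxy hef heg hfg he hf hg
          | exact .looseHandcuff G x y e f g hxy he hf hg
          | exact p1 ▸ .looseHandcuff G x y e g f hxy he hg hf
          | exact p2 ▸ .looseHandcuff G x y f e g hxy hf he hg
          | exact p3 ▸ .looseHandcuff G x y f g e hxy hf hg he
          | exact p4 ▸ .looseHandcuff G x y g e f hxy hg he hf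
          | exact p5 ▸ .looseHandcuff G x y g f e hxy hg hf he
          | (exfalso; omega)

/-- Hall's theorem turns a minimal set of edges without distinct representatives into a graph
with fewer vertices than edges. By minimality it has exactly one vertex fewer, so that
`isBicircularEdgeSet_of_card` applies. -/
theorem isBicircularEdgeSet_of_minimal {V E : Type*} [Finite V] [Nonempty V]
    {G : FreeEdgeGraph V E} {C : Set E} (hfin : C.Finite) (hC : ¬ Matchable G.endSet C)
    (hmin : ∀ e ∈ C, Matchable G.endSet (C \ {e})) :
    (∃ e, G.ends e = none ∧ C = {e}) ∨ IsBicircularEdgeSet G C := by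
  classical
  by_cases hfree : ∃ e ∈ C, G.ends e = none
  · left
    obtain ⟨e, he, hen⟩ := hfree
    refine ⟨e, hen, ?_⟩
    by_contra hne
    obtain ⟨f, hf, hfe⟩ : ∃ f ∈ C, f ≠ e := by
      by_contra! h
      exact hne (Set.eq_singleton_iff_unique_mem.2 ⟨he, h⟩)
    obtain ⟨φ, -, h2⟩ := hmin f hf
    obtain ⟨p, hp, -⟩ := h2 e ⟨he, hfe.symm⟩
    simp [hen] at hp
  · right
    push Not at hfree
    obtain ⟨C, rfl⟩ := hfin.exists_finset_coe
    obtain ⟨S, hS⟩ : ∃ S : Finset C,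
        (S.biUnion fun e => (G.endSet (e : E)).toFinite.toFinset).card < S.card := by
      by_contra! h
      obtain ⟨φ, h1, h2⟩ := (Finset.all_card_le_biUnion_card_iff_exists_injective _).1 h
      refine hC ⟨fun e => if he : e ∈ C then φ ⟨e, he⟩ else Classical.arbitrary V, ?_, ?_⟩
      · intro a ha b hb hab
        beta_reduce at hab
        rw [dif_pos (Finset.mem_coe.1 ha), dif_pos (Finset.mem_coe.1 hb)] at hab
        simpa using h1 hab
      · intro e he
        beta_reduce
        rw [dif_pos (Finset.mem_coe.1 he)]
        simpa using h2 ⟨e, he⟩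
    set W := S.biUnion fun e => (G.endSet (e : E)).toFinite.toFinset with hW
    have hlt : ∀ J ⊂ C, ∀ U : Finset V, (∀ e ∈ J, G.endSet e ⊆ U) → J.card ≤ U.card := by
      intro J hJ U hU
      obtain ⟨e, heC, heJ⟩ := Finset.exists_of_ssubset hJ
      have := ((hmin e heC).mono (I := (J : Set E)) fun f hf =>
        ⟨hJ.1 hf, fun h => heJ (h ▸ hf)⟩).ncard_le U hU
      rwa [Set.ncard_coe_finset] at this
    have hSC : S.map (Function.Embedding.subtype _) = C := by
      by_contra hne
      have hss : S.map (Function.Embedding.subtype _) ⊂ C :=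
        Finset.ssubset_iff_subset_ne.2 ⟨fun e he => by
          obtain ⟨a, -, rfl⟩ := Finset.mem_map.1 he
          exact a.2, hne⟩
      have := hlt _ hss W (by
        intro e he
        obtain ⟨a, ha, rfl⟩ := Finset.mem_map.1 he
        intro v hv
        exact Finset.mem_coe.2 (Finset.mem_biUnion.2 ⟨a, ha, by simpa using hv⟩))
      rw [Finset.card_map] at this
      omega
    have hWC : ∀ e ∈ C, G.endSet e ⊆ W := by
      intro e he v hv
      rw [← hSC] at he
      obtain ⟨a, ha, rfl⟩ := Finset.mem_map.1 he
      exact Finset.mem_coe.2 (Finset.mem_biUnion.2 ⟨a, ha, by simpa using hv⟩)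
    have hcard : S.card = C.card := by simpa using congrArg Finset.card hSC
    have hpos : 0 < C.card := by omega
    obtain ⟨e, he⟩ := Finset.card_pos.1 hpos
    have := hlt _ (Finset.erase_ssubset he) W fun f hf => hWC f (Finset.mem_of_mem_erase hf)
    rw [Finset.card_erase_of_mem he] at this
    exact isBicircularEdgeSet_of_card W.card G C W rfl (by omega) hfree hWC hlt

/-- In a bicircular matroid the independent sets are those with distinct representatives
among the ends of their edges. -/
theorem indep_iff_matchable {α V : Type*} [Finite V] [Nonempty V] {M : Matroid α}
    {G : FreeEdgeGraph V α} (hfin : M.E.Finite) (hM : ∀ C ⊆ M.E,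
      M.IsCircuit C ↔ (∃ e, G.ends e = none ∧ C = {e}) ∨ IsBicircularEdgeSet G C)
    {I : Set α} (hI : I ⊆ M.E) : M.Indep I ↔ Matchable G.endSet I := by
  constructor
  · intro hind
    by_contra hnot
    have hsub : {J | J ⊆ I ∧ ¬ Matchable G.endSet J}.Finite :=
      (hfin.subset hI).finite_subsets.subset fun J hJ => hJ.1
    obtain ⟨C, ⟨hCI, hCnot⟩, hCmin⟩ := hsub.exists_minimal ⟨I, Set.Subset.rfl, hnot⟩
    have hCfin := (hfin.subset hI).subset hCI
    have hcirc := (hM C (hCI.trans hI)).2 (isBicircularEdgeSet_of_minimal hCfin hCnot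
      fun e he => by
        by_contra hne
        exact (hCmin ⟨Set.sdiff_subset.trans hCI, hne⟩ Set.sdiff_subset he).2 rfl)
    exact hcirc.not_indep (hind.subset hCI)
  · intro hmatch
    by_contra hnot
    obtain ⟨C, hCI, hC⟩ := ((Matroid.not_indep_iff hI).1 hnot).exists_isCircuit_subset
    rcases (hM C (hCI.trans hI)).1 hC with ⟨e, he, rfl⟩ | hbi
    · obtain ⟨φ, -, h2⟩ := hmatch
      obtain ⟨p, hp, -⟩ := h2 e (hCI rfl)
      simp [he] at hp
    · exact hbi.not_matchable (hmatch.mono hCI)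

/-- A matroid whose independent sets are the sets of edges of a graph with distinct
representatives among their ends is bicircular. -/
theorem isBicircularMatroid_of_indep_iff {α : Type*} {M : Matroid α} {n : ℕ}
    {G : FreeEdgeGraph (Fin (n + 1)) α} (hfin : M.E.Finite)
    (hM : ∀ I ⊆ M.E, M.Indep I ↔ Matchable G.endSet I) : IsBicircularMatroid M := by
  refine ⟨⟨hfin⟩, n + 1, G, fun C hC => ?_⟩
  rw [Matroid.isCircuit_iff_dep_forall_sdiff_singleton_indep, Matroid.Dep, hM C hC,
    and_iff_left hC]
  constructor
  · rintro ⟨h1, h2⟩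
    exact isBicircularEdgeSet_of_minimal (hfin.subset hC) h1 fun e he =>
      (hM _ (Set.sdiff_subset.trans hC)).1 (h2 e he)
  · rintro (⟨e, he, rfl⟩ | h)
    · refine ⟨?_, by simp⟩
      rintro ⟨φ, -, h2⟩
      obtain ⟨p, hp, -⟩ := h2 e rfl
      simp [he] at hp
    · exact ⟨h.not_matchable, fun e he =>
        (hM _ (Set.sdiff_subset.trans hC)).2 (h.matchable_diff e he)⟩

/-! ### Transversal presentations -/

/-- If `I` and `B₀` have distinct representatives, and all of `0, …, r - 1` are used for `B₀`, then
`I` extends to a set with distinct representatives that uses all of `0, …, r - 1`. As in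
the Schröder–Bernstein theorem, one follows the alternating paths of the two
matchings that start at the values not used for `I`. -/
theorem Matchable.exists_superset {α : Type*} {A : α → Set ℕ} {r : ℕ} {I B₀ : Set α}
    (hI : Matchable A I) (hIr : ∀ e ∈ I, A e ⊆ Set.Iio r) (hB : Matchable A B₀)
    (hBr : ∀ e ∈ B₀, A e ⊆ Set.Iio r) (hcard : B₀.ncard = r) :
    ∃ B, I ⊆ B ∧ B ⊆ I ∪ B₀ ∧ B.ncard = r ∧ Matchable A B := by
  classical
  obtain ⟨φ, i1, i2⟩ := hI
  obtain ⟨ψ, b1, b2⟩ := hB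
  rcases Nat.eq_zero_or_pos r with rfl | hr
  · refine ⟨I, Set.Subset.rfl, Set.subset_union_left, ?_, φ, i1, i2⟩
    have : I = ∅ := Set.eq_empty_of_forall_notMem fun e he => by simpa using hIr e he (i2 e he)
    simp [this]
  have hsurj : ∀ v < r, ∃ b ∈ B₀, ψ b = v := by
    have himg : ψ '' B₀ = Set.Iio r := by
      refine Set.eq_of_subset_of_ncard_le ?_ ?_ (Set.finite_Iio r)
      · rintro _ ⟨b, hb, rfl⟩
        exact hBr b hb (b2 b hb)
      · rw [b1.ncard_image, hcard]
        simp
    intro v hv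
    have : v ∈ ψ '' B₀ := himg ▸ Set.mem_Iio.2 hv
    exact this
  obtain ⟨b₀, -, -⟩ := hsurj 0 hr
  have : ∀ v, ∃ b, v < r → b ∈ B₀ ∧ ψ b = v := by
    intro v
    by_cases hv : v < r
    · obtain ⟨b, hb⟩ := hsurj v hv
      exact ⟨b, fun _ => hb⟩
    · exact ⟨b₀, fun h => absurd h hv⟩
  choose g hg using this
  -- `g` is the inverse of `ψ`, and `S` is the set of values on alternating paths that start at
  -- values not used for `I`
  let S : ℕ → Prop := fun u => ∃ v < r, v ∉ φ '' I ∧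
    Relation.ReflTransGen (fun a b => g a ∈ I ∧ φ (g a) = b) v u
  have hS : ∀ u, S u → g u ∈ I → S (φ (g u)) := by
    rintro u ⟨v, hv, hvI, h⟩ hu
    exact ⟨v, hv, hvI, h.tail ⟨hu, rfl⟩⟩
  have hk : ∀ v, ∃ e, v < r → ¬ S v → e ∈ I ∧ φ e = v := by
    intro v
    by_cases h : v < r ∧ ¬ S v
    · have : v ∈ φ '' I := by
        by_contra hv
        exact h.2 ⟨v, h.1, hv, .refl⟩
      obtain ⟨e, he⟩ := this
      exact ⟨e, fun _ _ => he⟩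
    · exact ⟨b₀, fun h1 h2 => absurd ⟨h1, h2⟩ h⟩
  choose k hk using hk
  -- use the matching of `B₀` on `S`, and that of `I` elsewhere
  let h : ℕ → α := fun v => if S v then g v else k v
  have hinj : Set.InjOn h (Set.Iio r) := by
    have cross : ∀ u < r, ∀ v < r, S u → ¬ S v → g u ≠ k v := by
      intro u _ v hv hu hSv heq
      obtain ⟨h1, h2⟩ := hk v hv hSv
      apply hSv
      rw [← h2, ← heq]
      exact hS u hu (heq ▸ h1)
    intro u hu v hv huv
    simp only [h] at huv
    by_cases hSu : S u <;> by_cases hSv : S v <;> simp only [hSu, hSv, if_true, if_false] at huv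
    · rw [← (hg u hu).2, ← (hg v hv).2, huv]
    · exact absurd huv (cross u hu v hv hSu hSv)
    · exact absurd huv.symm (cross v hv u hu hSv hSu)
    · rw [← (hk u hu hSu).2, ← (hk v hv hSv).2, huv]
  refine ⟨h '' Set.Iio r, ?_, ?_, ?_, Function.invFunOn h (Set.Iio r), ?_, ?_⟩
  · intro e he
    have her : φ e < r := hIr e he (i2 e he)
    by_cases hSe : S (φ e)
    · obtain ⟨v, hv, hvI, hpath⟩ := hSe
      rcases Relation.ReflTransGen.cases_tail hpath with heq | ⟨u, hvu, hu, hu'⟩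
      · exact absurd ⟨e, he, heq⟩ hvI
      · have hSu : S u := ⟨v, hv, hvI, hvu⟩
        have hur : u < r := by
          rcases Relation.ReflTransGen.cases_tail hvu with rfl | ⟨w, -, hw, rfl⟩
          · exact hv
          · exact hIr _ hw (i2 _ hw)
        refine ⟨u, hur, ?_⟩
        simp only [h, if_pos hSu]
        exact i1 hu he hu'
    · refine ⟨φ e, her, ?_⟩
      simp only [h, if_neg hSe]
      exact i1 (hk _ her hSe).1 he (hk _ her hSe).2
  · rintro _ ⟨v, hv, rfl⟩
    simp only [h]
    split_ifs with hSv
    · exact Or.inr (hg v hv).1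
    · exact Or.inl (hk v hv hSv).1
  · rw [hinj.ncard_image]
    simp
  · exact (Function.invFunOn_injOn_image _ _)
  · rintro _ ⟨v, hv, rfl⟩
    rw [hinj.leftInvOn_invFunOn hv]
    simp only [h]
    split_ifs with hSv
    · have := b2 _ (hg v hv).1
      rwa [(hg v hv).2] at this
    · have := i2 _ (hk v hv hSv).1
      rwa [(hk v hv hSv).2] at this

/-- The matroid `M` has rank `r`, and its bases are the sets of `r` elements that have distinct
representatives in the finite sets `A e`, whose members are below `r`. -/
structure IsPresentation {α : Type*} (M : Matroid α) (r : ℕ) (A : α → Finset ℕ) : Prop where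
  finite : M.E.Finite
  lt : ∀ e ∈ M.E, ∀ v ∈ A e, v < r
  isBase_iff : ∀ B ⊆ M.E, M.IsBase B ↔ B.ncard = r ∧ Matchable (fun e => (A e : Set ℕ)) B

theorem IsPresentation.indep_iff {α : Type*} {M : Matroid α} {r : ℕ} {A : α → Finset ℕ}
    (h : IsPresentation M r A) {I : Set α} (hI : I ⊆ M.E) :
    M.Indep I ↔ Matchable (fun e => (A e : Set ℕ)) I := by
  constructor
  · intro hind
    obtain ⟨B, hB, hIB⟩ := hind.exists_isBase_superset
    exact ((h.isBase_iff B hB.subset_ground).1 hB).2.mono hIB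
  · intro hmatch
    obtain ⟨B₀, hB₀⟩ := M.exists_isBase
    obtain ⟨h1, h2⟩ := (h.isBase_iff B₀ hB₀.subset_ground).1 hB₀
    obtain ⟨B, hIB, hB, hBr, hBm⟩ := hmatch.exists_superset
      (fun e he v hv => h.lt e (hI he) v hv) h2
      (fun e he v hv => h.lt e (hB₀.subset_ground he) v hv) h1
    exact ((h.isBase_iff B (hB.trans (Set.union_subset hI hB₀.subset_ground))).2
      ⟨hBr, hBm⟩).indep.subset hIB

/-- If every element has at most two possible representatives, these are the ends of an edge. -/
theorem IsPresentation.isBicircularMatroid {α : Type*} {M : Matroid α} {r : ℕ} {A : α → Finset ℕ}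
    (h : IsPresentation M r A) (hA : ∀ e ∈ M.E, (A e).card ≤ 2) : IsBicircularMatroid M := by
  -- one extra vertex makes the vertex set nonempty
  let G : FreeEdgeGraph (Fin (r + 1)) α := ⟨fun e => if he : (A e).Nonempty then
    some s(Fin.ofNat (r + 1) ((A e).min' he), Fin.ofNat (r + 1) ((A e).max' he)) else none⟩
  have hG : ∀ e ∈ M.E, G.endSet e = Fin.ofNat (r + 1) '' (A e) := by
    intro e he
    by_cases hne : (A e).Nonempty
    · have : G.ends e = some s(Fin.ofNat (r + 1) ((A e).min' hne),
        Fin.ofNat (r + 1) ((A e).max' hne)) := dif_pos hne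
      rw [G.endSet_of_eq this, ← Set.image_pair]
      congr 1
      have h1 := (A e).min'_mem hne
      have h2 := (A e).max'_mem hne
      refine Set.Subset.antisymm (Set.pair_subset h1 h2) fun v hv => ?_
      by_contra hnot
      simp only [Set.mem_insert_iff, Set.mem_singleton_iff, not_or] at hnot
      have hlt : (A e).min' hne < (A e).max' hne :=
        ((A e).min'_le v hv).lt_of_ne' hnot.1 |>.trans_le ((A e).le_max' v hv)
      have h3 : ({v, (A e).min' hne, (A e).max' hne} : Finset ℕ) ⊆ A e := by
        simp [Finset.insert_subset_iff, h1, h2, Finset.mem_coe.1 hv]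
      have h4 := Finset.card_le_card h3
      rw [Finset.card_eq_three.2 ⟨_, _, _, hnot.1, hnot.2, hlt.ne, rfl⟩] at h4
      exact absurd (hA e he) (by omega)
    · have : G.ends e = none := dif_neg hne
      rw [Finset.not_nonempty_iff_eq_empty.1 hne]
      simp [FreeEdgeGraph.endSet, this]
  refine isBicircularMatroid_of_indep_iff (G := G) h.finite fun I hI => ?_
  rw [h.indep_iff hI]
  constructor
  · rintro ⟨φ, h1, h2⟩
    refine ⟨fun e => Fin.ofNat (r + 1) (φ e), fun a ha b hb hab => h1 ha hb ?_, fun e he => ?_⟩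
    · have := congrArg Fin.val hab
      simp only [Fin.ofNat] at this
      have ha' := h.lt a (hI ha) _ (h2 a ha)
      have hb' := h.lt b (hI hb) _ (h2 b hb)
      rwa [Nat.mod_eq_of_lt (by omega), Nat.mod_eq_of_lt (by omega)] at this
    · rw [hG e (hI he)]
      exact Set.mem_image_of_mem _ (h2 e he)
  · rintro ⟨φ, h1, h2⟩
    refine ⟨fun e => φ e, fun a ha b hb hab => h1 ha hb (Fin.ext hab), fun e he => ?_⟩
    have := h2 e he
    rw [hG e (hI he)] at this
    obtain ⟨v, hv, hv'⟩ := this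
    have hvr := h.lt e (hI he) v hv
    have : (φ e : ℕ) = v := by
      rw [← hv']
      exact Nat.mod_eq_of_lt (by omega)
    beta_reduce
    rwa [this]

/-! ### Lattice path matroids and their minors -/

/-- The number of elements of `B` whose label is below `k`. -/
noncomputable def countBelow {α : Type*} (f : α → ℕ) (B : Set α) (k : ℕ) : ℕ :=
  {b ∈ B | f b < k}.ncard

section countBelow

variable {α : Type*} {f : α → ℕ} {B : Set α}

theorem countBelow_zero : countBelow f B 0 = 0 := by
  simp [countBelow]

theorem countBelow_mono (hB : B.Finite) : Monotone (countBelow f B) := fun _ _ h =>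
  Set.ncard_le_ncard (fun _ hb => ⟨hb.1, hb.2.trans_le h⟩) (hB.subset (Set.sep_subset _ _))

theorem countBelow_le (hB : B.Finite) (k : ℕ) : countBelow f B k ≤ B.ncard :=
  Set.ncard_le_ncard (Set.sep_subset _ _) hB

theorem countBelow_eq_ncard {n : ℕ} (h : ∀ b ∈ B, f b < n) : countBelow f B n = B.ncard := by
  rw [countBelow, Set.sep_eq_self_iff_mem_true.2 h]

theorem countBelow_succ_of_mem (hB : B.Finite) (hf : Set.InjOn f B) {b : α} (hb : b ∈ B) :
    countBelow f B (f b + 1) = countBelow f B (f b) + 1 := by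
  rw [countBelow, countBelow, ← Set.ncard_insert_of_notMem (a := b) (by simp)
    (hB.subset (Set.sep_subset _ _))]
  congr 1
  ext c
  simp only [Set.mem_ofPred_eq, Set.mem_insert_iff, Order.lt_add_one_iff]
  constructor
  · rintro ⟨hc, hle⟩
    rcases hle.eq_or_lt with h | h
    · exact Or.inl (hf hc hb h)
    · exact Or.inr ⟨hc, h⟩
  · rintro (rfl | ⟨hc, h⟩)
    · exact ⟨hb, le_rfl⟩
    · exact ⟨hc, h.le⟩

theorem countBelow_succ_le (hB : B.Finite) (hf : Set.InjOn f B) (k : ℕ) :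
    countBelow f B (k + 1) ≤ countBelow f B k + 1 := by
  by_cases h : ∃ b ∈ B, f b = k
  · obtain ⟨b, hb, rfl⟩ := h
    exact (countBelow_succ_of_mem hB hf hb).le
  · refine le_trans (Set.ncard_le_ncard ?_ (hB.subset (Set.sep_subset _ _))) (Nat.le_succ _)
    rintro b ⟨hb, hlt⟩
    refine ⟨hb, lt_of_le_of_ne (Nat.lt_succ_iff.1 hlt) fun h' => h ⟨b, hb, h'⟩⟩

theorem countBelow_union {K : Set α} (hB : B.Finite) (hK : K.Finite) (h : Disjoint B K) (k : ℕ) :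
    countBelow f (B ∪ K) k = countBelow f B k + countBelow f K k := by
  rw [countBelow, countBelow, countBelow, ← Set.ncard_union_eq
    (h.mono (Set.sep_subset _ _) (Set.sep_subset _ _))
    (hB.subset (Set.sep_subset _ _)) (hK.subset (Set.sep_subset _ _))]
  congr 1
  ext c
  simp [or_and_right]

end countBelow

theorem LatticePath.height_eq_countBelow {n : ℕ} (R : LatticePath n) :
    R.height = countBelow Fin.val R.norths := rfl

theorem LatticePath.height_mono {n : ℕ} (R : LatticePath n) : Monotone R.height :=
  countBelow_mono (Set.toFinite _)

theorem LatticePath.exists_norths_eq {n : ℕ} (S : Set (Fin n)) :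
    ∃ R : LatticePath n, S = R.norths := by
  classical
  refine ⟨fun i => if i ∈ S then .north else .east, ?_⟩
  ext i
  simp only [LatticePath.norths, Set.mem_ofPred_eq]
  split_ifs with h <;> simp [h]

/-- The path whose heights are given by a function with increments `0` and `1`. -/
noncomputable def pathOfHeight (n : ℕ) (h : ℕ → ℕ) : LatticePath n := fun i =>
  if h (i + 1) = h i + 1 then Step.north else Step.east

theorem height_pathOfHeight {n : ℕ} {h : ℕ → ℕ} (h0 : h 0 = 0) (h1 : ∀ k, h k ≤ h (k + 1))
    (h2 : ∀ k, h (k + 1) ≤ h k + 1) : ∀ k ≤ n, (pathOfHeight n h).height k = h k := by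
  intro k
  rw [LatticePath.height_eq_countBelow]
  induction k with
  | zero => intro _; rw [countBelow_zero, h0]
  | succ k ih =>
    intro hk
    by_cases hstep : h (k + 1) = h k + 1
    · have hmem : (⟨k, hk⟩ : Fin n) ∈ (pathOfHeight n h).norths := by
        simp [LatticePath.norths, pathOfHeight, hstep]
      rw [hstep, ← ih (by omega)]
      exact countBelow_succ_of_mem (Set.toFinite _) (Fin.val_injective.injOn) hmem
    · rw [show h (k + 1) = h k by have := h1 k; have := h2 k; omega, ← ih (by omega)]
      refine congrArg Set.ncard (Set.ext fun i => ?_)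
      simp only [Set.mem_ofPred_eq]
      refine and_congr_right fun hi => ?_
      have hne : (i : ℕ) ≠ k := by
        intro hik
        apply hstep
        by_contra hno
        simp [LatticePath.norths, pathOfHeight, hik, hno] at hi
      omega

theorem countBelow_image_val {α : Type*} {X : Set α} {n : ℕ} {g : α → ℕ} {e : X → Fin n}
    (he : Function.Injective e) (hg : ∀ x, g x.1 = e x) (B : Set X) (k : ℕ) :
    countBelow Fin.val (e '' B) k = countBelow g (Subtype.val '' B) k := by
  have h1 : {i ∈ e '' B | (i : ℕ) < k} = e '' {x ∈ B | g x.1 < k} := by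
    ext i
    simp only [Set.mem_ofPred_eq, Set.mem_image]
    constructor
    · rintro ⟨⟨x, hx, rfl⟩, hk⟩
      exact ⟨x, ⟨hx, by rwa [hg]⟩, rfl⟩
    · rintro ⟨x, ⟨hx, hk⟩, rfl⟩
      exact ⟨⟨x, hx, rfl⟩, by rwa [← hg]⟩
  have h2 : {a ∈ (Subtype.val '' B : Set α) | g a < k} = Subtype.val '' {x ∈ B | g x.1 < k} := by
    ext a
    simp only [Set.mem_ofPred_eq, Set.mem_image]
    constructor
    · rintro ⟨⟨x, hx, rfl⟩, hk⟩
      exact ⟨x, ⟨hx, hk⟩, rfl⟩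
    · rintro ⟨x, ⟨hx, hk⟩, rfl⟩
      exact ⟨⟨x, hx, rfl⟩, hk⟩
  rw [countBelow, countBelow, h1, h2, Set.ncard_image_of_injective _ he,
    Set.ncard_image_of_injective _ Subtype.val_injective]

/-- A lattice path matroid, with its elements labelled by positions: the bases are described
by bounds on the number of their elements in each initial segment. -/
theorem IsLatticePathMatroid.exists_labelling {α : Type*} {M : Matroid α}
    (hM : IsLatticePathMatroid M) : ∃ (n : ℕ) (P Q : LatticePath n) (f : α → ℕ),
      M.E.Finite ∧ Set.InjOn f M.E ∧ (∀ i < n, ∃ e ∈ M.E, f e = i) ∧ (∀ e ∈ M.E, f e < n) ∧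
      P.height n = Q.height n ∧ P.Below Q ∧ ∀ B ⊆ M.E, M.IsBase B ↔ B.ncard = P.height n ∧
        ∀ k ≤ n, P.height k ≤ countBelow f B k ∧ countBelow f B k ≤ Q.height k := by
  classical
  obtain ⟨n, P, Q, hPQ, hbelow, e, he⟩ := hM
  let f : α → ℕ := fun a => if h : a ∈ M.E then e ⟨a, h⟩ else 0
  have hf : ∀ x : M.E, f x.1 = e x := fun x => dif_pos x.2
  refine ⟨n, P, Q, f, Finite.of_equiv _ e.symm, ?_, ?_, ?_, hPQ,
    hbelow, ?_⟩
  · intro a ha b hb hab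
    have h1 := hf ⟨a, ha⟩
    have h2 := hf ⟨b, hb⟩
    have : e ⟨a, ha⟩ = e ⟨b, hb⟩ := Fin.ext (by rw [← h1, ← h2]; exact hab)
    exact congrArg Subtype.val (e.injective this)
  · intro i hi
    exact ⟨(e.symm ⟨i, hi⟩).1, (e.symm ⟨i, hi⟩).2, by rw [hf]; simp⟩
  · intro a ha
    rw [hf ⟨a, ha⟩]
    exact Fin.is_lt _
  · intro B hB
    have hB' : Subtype.val '' (Subtype.val ⁻¹' B : Set M.E) = B := by
      rw [Subtype.image_preimage_coe, Set.inter_eq_right.2 hB]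
    have hcount := countBelow_image_val e.injective hf (Subtype.val ⁻¹' B)
    rw [hB'] at hcount
    have hn : countBelow f B n = B.ncard := countBelow_eq_ncard fun b hb => by
      rw [hf ⟨b, hB hb⟩]
      exact Fin.is_lt _
    have := he (Subtype.val ⁻¹' B)
    rw [hB'] at this
    rw [this]
    constructor
    · rintro ⟨R, hR, hPR, hRQ, hBR⟩
      have hh : R.height = countBelow f B := by
        ext k
        rw [LatticePath.height_eq_countBelow, ← hBR, hcount]
      refine ⟨by rw [← hn, ← hh, hR], fun k hk => ?_⟩
      rw [← hh]
      exact ⟨hPR k hk, hRQ k hk⟩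
    · rintro ⟨hBn, hk⟩
      obtain ⟨R, hBR⟩ := LatticePath.exists_norths_eq (e '' (Subtype.val ⁻¹' B))
      have hh : R.height = countBelow f B := by
        ext k
        rw [LatticePath.height_eq_countBelow, ← hBR, hcount]
      refine ⟨R, by rw [hh, hn, hBn], ?_, ?_, hBR⟩
      · intro k hkn
        rw [hh]
        exact (hk k hkn).1
      · intro k hkn
        rw [hh]
        exact (hk k hkn).2

/-- The bases of `M` are the `r`-element sets whose numbers of elements in the initial segments of a
linear order of the ground set obey given bounds. The order is given by labels `f`, which need
not be consecutive, and the bounds are arbitrary integers; unlike a pair of bounding paths, such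
data are easily passed on to minors. -/
def IsCountConstrained {α : Type*} (M : Matroid α) : Prop :=
  ∃ (f : α → ℕ) (n r : ℕ) (p q : ℕ → ℤ), M.E.Finite ∧ Set.InjOn f M.E ∧
    ∀ B ⊆ M.E, M.IsBase B ↔ B.ncard = r ∧
      ∀ k ≤ n, p k ≤ countBelow f B k ∧ countBelow f B k ≤ q k

theorem IsLatticePathMatroid.isCountConstrained {α : Type*} {M : Matroid α}
    (hM : IsLatticePathMatroid M) : IsCountConstrained M := by
  obtain ⟨n, P, Q, f, hfin, hf, -, -, -, -, hB⟩ := hM.exists_labelling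
  refine ⟨f, n, P.height n, fun k => P.height k, fun k => Q.height k, hfin, hf, fun B hBE => ?_⟩
  rw [hB B hBE]
  simp only [Nat.cast_le]

/-- The pointwise minimum and maximum of the height functions of all bases are again the height
functions of paths. These two paths present the matroid, because any path between them satisfies
the given bounds. -/
theorem IsCountConstrained.isLatticePathMatroid {α : Type*} {M : Matroid α}
    (hM : IsCountConstrained M) : IsLatticePathMatroid M := by
  classical
  obtain ⟨f, n, r, p, q, hfin, hf, hbase⟩ := hM
  set N := M.E.ncard with hN
  -- `g` replaces the labels by the positions
  let g : α → ℕ := fun a => countBelow f M.E (f a)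
  have hlt : ∀ a ∈ M.E, ∀ k, f a < k ↔ g a < countBelow f M.E k := by
    intro a ha k
    constructor
    · intro h
      have h1 := countBelow_succ_of_mem hfin hf ha
      have h2 := countBelow_mono (f := f) hfin (show f a + 1 ≤ k from h)
      simp only [g]
      omega
    · intro h
      by_contra! hle
      exact absurd (countBelow_mono (f := f) hfin hle) (not_le.2 h)
  have hgN : ∀ a ∈ M.E, g a < N := by
    intro a ha
    exact ((hlt a ha (f a + 1)).1 (Nat.lt_succ_self _)).trans_le (countBelow_le hfin _)
  have hg : Set.InjOn g M.E := by
    intro a ha b hb hab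
    rcases lt_trichotomy (f a) (f b) with h | h | h
    · have := (hlt a ha _).1 h
      exact absurd hab this.ne
    · exact hf ha hb h
    · have := (hlt b hb _).1 h
      exact absurd hab.symm this.ne
  have hcount : ∀ B ⊆ M.E, ∀ k, countBelow f B k = countBelow g B (countBelow f M.E k) := by
    intro B hB k
    refine congrArg Set.ncard (Set.ext fun b => ?_)
    exact and_congr_right fun hb => hlt b (hB hb) k
  have : Fintype M.E := hfin.fintype
  let e₀ : M.E → Fin N := fun x => ⟨g x.1, hgN x.1 x.2⟩
  have he₀ : Function.Bijective e₀ := by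
    rw [Fintype.bijective_iff_injective_and_card]
    refine ⟨fun x y hxy => Subtype.ext (hg x.2 y.2 (congrArg Fin.val hxy)), ?_⟩
    rw [Fintype.card_fin, hN, ← Nat.card_coe_set_eq, Nat.card_eq_fintype_card]
  let e : M.E ≃ Fin N := Equiv.ofBijective e₀ he₀
  have hge : ∀ x : M.E, g x.1 = e x := fun x => rfl
  have hBfin : ∀ {B}, M.IsBase B → B.Finite := fun hB => hfin.subset hB.subset_ground
  have hBinj : ∀ {B}, M.IsBase B → Set.InjOn g B := fun hB => hg.mono hB.subset_ground
  let S : ℕ → Set ℕ := fun k => {j | ∃ B, M.IsBase B ∧ countBelow g B k = j}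
  have hSne : ∀ k, (S k).Nonempty := fun k => by
    obtain ⟨B, hB⟩ := M.exists_isBase
    exact ⟨_, B, hB, rfl⟩
  have hSbdd : ∀ k, BddAbove (S k) := fun k => ⟨N, by
    rintro _ ⟨B, hB, rfl⟩
    exact (countBelow_le (hBfin hB) k).trans (Set.ncard_le_ncard hB.subset_ground hfin)⟩
  have hmin : ∀ {B}, M.IsBase B → ∀ k, sInf (S k) ≤ countBelow g B k :=
    fun hB k => Nat.sInf_le ⟨_, hB, rfl⟩
  have hmax : ∀ {B}, M.IsBase B → ∀ k, countBelow g B k ≤ sSup (S k) :=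
    fun hB k => le_csSup (hSbdd k) ⟨_, hB, rfl⟩
  have hP := height_pathOfHeight (n := N) (h := fun k => sInf (S k))
    (by
      obtain ⟨B, hB⟩ := M.exists_isBase
      have := hmin hB 0
      rwa [countBelow_zero, Nat.le_zero] at this)
    (fun k => by
      obtain ⟨B, hB, h⟩ := Nat.sInf_mem (hSne (k + 1))
      rw [← h]
      exact (hmin hB k).trans (countBelow_mono (hBfin hB) (Nat.le_succ k)))
    (fun k => by
      obtain ⟨B, hB, h⟩ := Nat.sInf_mem (hSne k)
      rw [← h]
      exact (hmin hB (k + 1)).trans (countBelow_succ_le (hBfin hB) (hBinj hB) k))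
  have hQ := height_pathOfHeight (n := N) (h := fun k => sSup (S k))
    (by
      obtain ⟨B, hB, h⟩ := Nat.sSup_mem (hSne 0) (hSbdd 0)
      rw [← h, countBelow_zero])
    (fun k => by
      obtain ⟨B, hB, h⟩ := Nat.sSup_mem (hSne k) (hSbdd k)
      rw [← h]
      exact (countBelow_mono (hBfin hB) (Nat.le_succ k)).trans (hmax hB (k + 1)))
    (fun k => by
      obtain ⟨B, hB, h⟩ := Nat.sSup_mem (hSne (k + 1)) (hSbdd (k + 1))
      rw [← h]
      exact (countBelow_succ_le (hBfin hB) (hBinj hB) k).trans (Nat.succ_le_succ (hmax hB k)))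
  have hSN : ∀ j ∈ S N, j = r := by
    rintro _ ⟨B, hB, rfl⟩
    rw [countBelow_eq_ncard fun b hb => hgN b (hB.subset_ground hb)]
    exact ((hbase B hB.subset_ground).1 hB).1
  have hPN : (pathOfHeight N fun k => sInf (S k)).height N = r := by
    rw [hP N le_rfl]
    exact hSN _ (Nat.sInf_mem (hSne N))
  have hQN : (pathOfHeight N fun k => sSup (S k)).height N = r := by
    rw [hQ N le_rfl]
    exact hSN _ (Nat.sSup_mem (hSne N) (hSbdd N))
  refine ⟨N, pathOfHeight N fun k => sInf (S k), pathOfHeight N fun k => sSup (S k),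
    hPN.trans hQN.symm, ?_, e, fun B => ?_⟩
  · intro k hk
    rw [hP k hk, hQ k hk]
    obtain ⟨B, hB⟩ := M.exists_isBase
    exact (hmin hB k).trans (hmax hB k)
  · have hBE : Subtype.val '' B ⊆ M.E := by simp
    constructor
    · intro hB
      obtain ⟨R, hBR⟩ := LatticePath.exists_norths_eq (e '' B)
      have hR : ∀ k, R.height k = countBelow g (Subtype.val '' B) k := fun k => by
        rw [LatticePath.height_eq_countBelow, ← hBR, countBelow_image_val e.injective hge]
      refine ⟨R, ?_, ?_, ?_, hBR⟩
      · rw [hPN, hR]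
        exact hSN _ ⟨_, hB, rfl⟩
      · intro k hk
        rw [hP k hk, hR]
        exact hmin hB k
      · intro k hk
        rw [hQ k hk, hR]
        exact hmax hB k
    · rintro ⟨R, hRN, hPR, hRQ, hBR⟩
      have hR : ∀ k, R.height k = countBelow g (Subtype.val '' B) k := fun k => by
        rw [LatticePath.height_eq_countBelow, ← hBR, countBelow_image_val e.injective hge]
      rw [hbase _ hBE]
      refine ⟨?_, fun k hk => ?_⟩
      · rw [← hPN, ← hRN, hR, countBelow_eq_ncard fun b hb => hgN b (hBE hb)]
      · have hkN : countBelow f M.E k ≤ N := countBelow_le hfin k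
        have h1 := hPR _ hkN
        have h2 := hRQ _ hkN
        rw [hP _ hkN, hR, ← hcount _ hBE] at h1
        rw [hQ _ hkN, hR, ← hcount _ hBE] at h2
        obtain ⟨B₁, hB₁, e₁⟩ := Nat.sInf_mem (hSne (countBelow f M.E k))
        obtain ⟨B₂, hB₂, e₂⟩ := Nat.sSup_mem (hSne (countBelow f M.E k)) (hSbdd _)
        rw [← e₁, ← hcount _ hB₁.subset_ground] at h1
        rw [← e₂, ← hcount _ hB₂.subset_ground] at h2
        have k1 := (((hbase B₁ hB₁.subset_ground).1 hB₁).2 k hk).1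
        have k2 := (((hbase B₂ hB₂.subset_ground).1 hB₂).2 k hk).2
        omega

/-- If the bases of `N` are the sets that a fixed set `K` completes to a base of `M`, then
the bounds for `M` give bounds for `N`. -/
theorem IsCountConstrained.of_isBase_union {α : Type*} {M N : Matroid α} {K : Set α}
    (hM : IsCountConstrained M) (hNE : N.E ⊆ M.E) (hK : K ⊆ M.E) (hKN : Disjoint N.E K)
    (hN : ∀ B ⊆ N.E, N.IsBase B ↔ M.IsBase (B ∪ K)) : IsCountConstrained N := by
  obtain ⟨f, n, r, p, q, hfin, hf, hbase⟩ := hM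
  obtain ⟨B₀, hB₀⟩ := N.exists_isBase
  have hKfin := hfin.subset hK
  have hr : K.ncard ≤ r := by
    have h1 := (hN B₀ hB₀.subset_ground).1 hB₀
    rw [← ((hbase _ h1.subset_ground).1 h1).1]
    exact Set.ncard_le_ncard Set.subset_union_right (hfin.subset h1.subset_ground)
  refine ⟨f, n, r - K.ncard, fun k => p k - countBelow f K k, fun k => q k - countBelow f K k,
    hfin.subset hNE, hf.mono hNE, fun B hB => ?_⟩
  have hBfin := hfin.subset (hB.trans hNE)
  have hd : Disjoint B K := hKN.mono_left hB
  rw [hN B hB, hbase _ (Set.union_subset (hB.trans hNE) hK), Set.ncard_union_eq hd hBfin hKfin]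
  refine and_congr (by omega) (forall₂_congr fun k _ => ?_)
  rw [countBelow_union hBfin hKfin hd]
  push_cast
  constructor <;> rintro ⟨h1, h2⟩ <;> constructor <;> linarith

theorem IsCountConstrained.contract {α : Type*} {M : Matroid α} (hM : IsCountConstrained M)
    {C : Set α} (hC : C ⊆ M.E) : IsCountConstrained (M.contract C) := by
  -- contracting `C` adds a basis of `C` to every base
  obtain ⟨I, hI⟩ := M.exists_isBasis C hC
  refine hM.of_isBase_union (K := I) Set.sdiff_subset hI.indep.subset_ground
    (Set.disjoint_sdiff_left.mono_right hI.subset) fun B hB => ?_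
  have hBC : Disjoint C B := (Set.disjoint_sdiff_left.mono_left hB).symm
  have hind : ∀ J, (M.contract C).Indep J ↔ M.Indep (J ∪ I) ∧ Disjoint C J :=
    fun J => hI.contract_indep_iff
  rw [Matroid.isBase_iff_maximal_indep, Matroid.isBase_iff_maximal_indep]
  constructor
  · intro h
    refine ⟨((hind B).1 h.1).1, fun J hJ hBJ => ?_⟩
    have hJC : J ∩ C = I := (hI.eq_of_subset_indep (hJ.subset Set.inter_subset_left)
      (Set.subset_inter (Set.subset_union_right.trans hBJ) hI.subset) Set.inter_subset_right).symm
    have hJ' : J \ C ∪ I = J := by rw [← hJC, Set.sdiff_union_inter]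
    have := h.2 ((hind (J \ C)).2 ⟨hJ'.symm ▸ hJ, Set.disjoint_sdiff_right⟩)
      (fun b hb => ⟨hBJ (Or.inl hb), fun hbC => hBC.ne_of_mem hbC hb rfl⟩)
    rw [← hJ']
    exact Set.union_subset_union_left _ this
  · intro h
    refine ⟨(hind B).2 ⟨h.1, hBC⟩, fun J hJ hBJ b hb => ?_⟩
    rw [hind] at hJ
    rcases h.2 hJ.1 (Set.union_subset_union_left _ hBJ) (Or.inl hb) with h | h
    · exact h
    · exact absurd rfl (hJ.2.ne_of_mem (hI.subset h) hb)

theorem IsCountConstrained.delete {α : Type*} {M : Matroid α} (hM : IsCountConstrained M)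
    (D : Set α) : IsCountConstrained (M.delete D) := by
  have hfin : M.E.Finite := by obtain ⟨_, _, _, _, _, h, -⟩ := hM; exact h
  obtain ⟨J, hJ⟩ := M.exists_isBasis (M.E \ D) Set.sdiff_subset
  -- the bases of `M ＼ D` are completed to bases of `M` by the rest of any base `B₀` that
  -- contains a basis of `M.E \ D`
  obtain ⟨B₀, hB₀, hJB⟩ := hJ.exists_isBase
  set X := M.E \ D with hX
  have hXE : X ⊆ M.E := Set.sdiff_subset
  have hB₀fin := hfin.subset hB₀.subset_ground
  have hunion : J ∪ B₀ \ X = B₀ := by rw [hJB, Set.inter_union_sdiff]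
  have hcard : ∀ B, M.IsBasis B X → B.ncard = J.ncard := fun B hB => by
    rw [Set.ncard, hB.encard_eq_encard hJ, Set.ncard]
  have hB₀card : B₀.ncard = J.ncard + (B₀ \ X).ncard := by
    rw [hJB, Set.ncard_inter_add_ncard_sdiff_eq_ncard _ _ hB₀fin]
  refine hM.of_isBase_union (K := B₀ \ X) hXE (Set.sdiff_subset.trans hB₀.subset_ground)
    Set.disjoint_sdiff_right fun B hB => ?_
  have hBX : B ⊆ X := hB
  have hBfin := hfin.subset (hBX.trans hXE)
  have hd : Disjoint B (B₀ \ X) := Set.disjoint_sdiff_right.mono_left hBX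
  have hBcard : (B ∪ B₀ \ X).ncard = B.ncard + (B₀ \ X).ncard :=
    Set.ncard_union_eq hd hBfin (hB₀fin.subset Set.sdiff_subset)
  rw [Matroid.delete_isBase_iff]
  constructor
  · intro h
    have hcl : M.closure (B ∪ B₀ \ X) = M.E := by
      rw [M.closure_union_congr_left (h.closure_eq_closure.trans hJ.closure_eq_closure.symm),
        hunion, hB₀.closure_eq]
    have hE : B ∪ B₀ \ X ⊆ M.E :=
      Set.union_subset (hBX.trans hXE) (Set.sdiff_subset.trans hB₀.subset_ground)
    obtain ⟨B₁, hB₁, hsub⟩ := ((Matroid.spanning_iff_closure_eq hE).2 hcl).exists_isBase_subset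
    rwa [← Set.eq_of_subset_of_ncard_le hsub (by
      rw [hB₁.ncard_eq_ncard_of_isBase hB₀, hBcard, hB₀card, hcard B h]) (hfin.subset hE)]
  · intro h
    obtain ⟨B', hB', hsub⟩ := (h.indep.subset Set.subset_union_left).subset_isBasis_of_subset hBX
    have h1 := h.ncard_eq_ncard_of_isBase hB₀
    have h2 := hcard B' hB'
    rwa [Set.eq_of_subset_of_ncard_le hsub (by omega) (hfin.subset (hB'.subset.trans hXE))]

theorem IsLatticePathMatroid.of_isMinor {α : Type*} {M N : Matroid α}
    (hM : IsLatticePathMatroid M) (h : N ≤m M) : IsLatticePathMatroid N := by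
  obtain ⟨C, D, hC, -, -, rfl⟩ := h.exists_eq_contract_delete_disjoint
  exact ((hM.isCountConstrained.contract hC).delete D).isLatticePathMatroid

/-! ### Doubled uniform matroids are not bicircular -/

/-- A rank-three matroid on seven elements, obtained from a uniform matroid by doubling
elements: the elements of a class of `cls` are parallel, at most two elements lie in a class, and
there are no other dependent sets with at most three elements. -/
structure IsDoubledUniform {α : Type*} (M : Matroid α) (cls : α → ℕ) : Prop where
  ncard_ground : M.E.ncard = 7
  indep_iff : ∀ I ⊆ M.E, M.Indep I ↔ I.ncard ≤ 3 ∧ Set.InjOn cls I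
  class_le_two : ∀ a ∈ M.E, ∀ b ∈ M.E, ∀ c ∈ M.E, cls a = cls b → cls a = cls c →
    a = b ∨ a = c ∨ b = c

theorem IsDoubledUniform.of_isIsoTo {α β : Type*} {M : Matroid α} {N : Matroid β} {cls : β → ℕ}
    (hN : IsDoubledUniform N cls) (h : IsIsoTo M N) : ∃ cls', IsDoubledUniform M cls' := by
  classical
  obtain ⟨e, he⟩ := h
  let cls' : α → ℕ := fun a => if h : a ∈ M.E then cls (e ⟨a, h⟩) else 0
  have hcls : ∀ x : M.E, cls' x.1 = cls (e x) := fun x => dif_pos x.2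
  refine ⟨cls', ?_, fun I hI => ?_, ?_⟩
  · rw [← hN.ncard_ground, ← Nat.card_coe_set_eq, ← Nat.card_coe_set_eq, Nat.card_congr e]
  · have hI' : Subtype.val '' (Subtype.val ⁻¹' I : Set M.E) = I := by
      rw [Subtype.image_preimage_coe, Set.inter_eq_right.2 hI]
    have := he (Subtype.val ⁻¹' I)
    rw [hI'] at this
    rw [this, hN.indep_iff _ (by simp)]
    refine and_congr ?_ ?_
    · rw [Set.ncard_image_of_injective _ Subtype.val_injective,
        Set.ncard_image_of_injective _ e.injective,
        ← Set.ncard_image_of_injective _ Subtype.val_injective, hI']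
    · constructor
      · intro h a ha b hb hab
        rw [hcls ⟨a, hI ha⟩, hcls ⟨b, hI hb⟩] at hab
        have := h ⟨_, ⟨_, ha, rfl⟩, rfl⟩ ⟨_, ⟨_, hb, rfl⟩, rfl⟩ hab
        exact congrArg Subtype.val (e.injective (Subtype.val_injective this))
      · rintro h _ ⟨_, ⟨a, ha, rfl⟩, rfl⟩ _ ⟨_, ⟨b, hb, rfl⟩, rfl⟩ hab
        rw [← hcls, ← hcls] at hab
        rw [Subtype.ext (h ha hb hab)]
  · intro a ha b hb c hc hab hac
    rw [hcls ⟨a, ha⟩, hcls ⟨b, hb⟩] at hab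
    rw [hcls ⟨a, ha⟩, hcls ⟨c, hc⟩] at hac
    have key : ∀ x y : M.E, (e x : β) = e y → x.1 = y.1 := fun x y h =>
      congrArg Subtype.val (e.injective (Subtype.ext h))
    rcases hN.class_le_two _ (e ⟨a, ha⟩).2 _ (e ⟨b, hb⟩).2 _ (e ⟨c, hc⟩).2 hab hac with h | h | h
    · exact Or.inl (key _ _ h)
    · exact Or.inr (Or.inl (key _ _ h))
    · exact Or.inr (Or.inr (key _ _ h))

/-- There are at least four classes, so there is a circuit with four elements, one from each of
four classes. -/
theorem IsDoubledUniform.exists_isCircuit {α : Type*} {M : Matroid α} {cls : α → ℕ}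
    (h : IsDoubledUniform M cls) : ∃ C, M.IsCircuit C ∧ C.ncard = 4 := by
  classical
  have hfin : M.E.Finite := Set.finite_of_ncard_pos (by rw [h.ncard_ground]; norm_num)
  obtain ⟨E, hE⟩ := hfin.exists_finset_coe
  have hE7 : E.card = 7 := by rw [← Set.ncard_coe_finset, hE, h.ncard_ground]
  have himg : 4 ≤ (E.image cls).card := by
    have := Finset.card_le_mul_card_image (f := cls) E 2 (by
      intro c _
      by_contra! hlt
      obtain ⟨x, hx, y, hy, z, hz, hxy, hxz, hyz⟩ := Finset.two_lt_card.1 hlt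
      simp only [Finset.mem_filter] at hx hy hz
      have hmem : ∀ {a}, a ∈ E → a ∈ M.E := fun ha => hE ▸ Finset.mem_coe.2 ha
      rcases h.class_le_two x (hmem hx.1) y (hmem hy.1) z (hmem hz.1) (by rw [hx.2, hy.2])
        (by rw [hx.2, hz.2]) with h | h | h
      · exact hxy h
      · exact hxz h
      · exact hyz h)
    omega
  obtain ⟨t, ht, ht4⟩ := Finset.exists_subset_card_eq himg
  have hsurj : Set.SurjOn cls M.E t := by
    intro c hc
    obtain ⟨a, ha, hac⟩ := Finset.mem_image.1 (ht hc)
    exact ⟨a, hE ▸ Finset.mem_coe.2 ha, hac⟩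
  obtain ⟨C, hCE, hC⟩ := hsurj.exists_bijOn_subset
  have hC4 : C.ncard = 4 := by
    rw [← hC.injOn.ncard_image, hC.image_eq, Set.ncard_coe_finset, ht4]
  refine ⟨C, ?_, hC4⟩
  rw [Matroid.isCircuit_iff_dep_forall_sdiff_singleton_indep, Matroid.Dep, h.indep_iff C hCE]
  refine ⟨⟨fun hle => by omega, hCE⟩, fun e he => ?_⟩
  rw [h.indep_iff _ (Set.sdiff_subset.trans hCE)]
  refine ⟨?_, hC.injOn.mono Set.sdiff_subset⟩
  rw [Set.ncard_sdiff_singleton_of_mem he, hC4]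

theorem FreeEdgeGraph.card_le_two_of_subset_endSet {V E : Type*} {G : FreeEdgeGraph V E} {e : E}
    {U : Finset V} (h : (U : Set V) ⊆ G.endSet e) : U.card ≤ 2 := by
  classical
  rcases U.eq_empty_or_nonempty with rfl | ⟨v, hv⟩
  · simp
  · obtain ⟨p, hp, -⟩ := h hv
    induction p using Sym2.ind with
    | _ x y =>
      rw [G.endSet_of_eq hp] at h
      exact (Finset.card_le_card (t := {x, y}) fun u hu => by simpa using h hu).trans
        Finset.card_le_two

/-- In a graph for such a matroid, the edges of a four-element circuit have three ends, and the
rank leaves no room for others. Every edge misses one of these three vertices, and an edge with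
a parallel one misses two of them. So every edge can be assigned a vertex that it misses, with
parallel edges getting different vertices. Three of the seven edges get the same vertex;
they are independent, and have only two ends. -/
theorem IsDoubledUniform.not_isBicircularMatroid {α : Type*} {M : Matroid α} {cls : α → ℕ}
    (h : IsDoubledUniform M cls) : ¬ IsBicircularMatroid M := by
  classical
  rintro ⟨-, n, G, hG⟩
  have hfin : M.E.Finite := Set.finite_of_ncard_pos (by rw [h.ncard_ground]; norm_num)
  obtain ⟨C, hC, hC4⟩ := h.exists_isCircuit
  have hCE := hC.subset_ground
  have hbi : IsBicircularEdgeSet G C := by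
    rcases (hG C hCE).1 hC with ⟨e, -, rfl⟩ | hbi
    · simp at hC4
    · exact hbi
  obtain ⟨f, hf⟩ : C.Nonempty := Set.nonempty_of_ncard_ne_zero (by omega)
  obtain ⟨W, hW, hends⟩ := hbi.exists_card_lt.2
  obtain ⟨φ, h1, h2⟩ := hbi.matchable_diff f hf
  have hV : Nonempty (Fin n) := ⟨φ f⟩
  have hind : ∀ I ⊆ M.E, M.Indep I ↔ Matchable G.endSet I :=
    fun I hI => indep_iff_matchable hfin hG hI
  have hCf : (C \ {f}).ncard = 3 := by rw [Set.ncard_sdiff_singleton_of_mem hf, hC4]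
  have hW3 : W.card = 3 := by
    have := Matchable.ncard_le ⟨φ, h1, h2⟩ W fun e he => hends e he.1
    omega
  have hEW : ∀ e ∈ M.E, G.endSet e ⊆ W := by
    intro e he
    by_cases heC : e ∈ C
    · exact hends e heC
    · intro v hv
      by_contra hvW
      have hnot : e ∉ C \ {f} := fun h => heC h.1
      have hm := Matchable.insert h1 h2 hnot hv fun a ha hav =>
        hvW (hends a ha.1 (hav ▸ h2 a ha))
      have hsub : insert e (C \ {f}) ⊆ M.E :=
        Set.insert_subset he (Set.sdiff_subset.trans hCE)
      have := ((h.indep_iff _ hsub).1 ((hind _ hsub).2 hm)).1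
      rw [Set.ncard_insert_of_notMem hnot (hfin.subset (Set.sdiff_subset.trans hCE))] at this
      omega
  have miss : ∀ e, ∃ v ∈ W, v ∉ G.endSet e := by
    intro e
    by_contra! hsub
    have := G.card_le_two_of_subset_endSet hsub
    omega
  -- otherwise `e` has two ends, one of which does not represent the parallel edge `b`
  have miss_two : ∀ e x, e ∈ M.E → (∃ b ∈ M.E, b ≠ e ∧ cls b = cls e) →
      ∃ v ∈ W, v ≠ x ∧ v ∉ G.endSet e := by
    rintro e x he ⟨b, hb, hbe, hcls⟩
    by_contra! hsub
    have hbm : Matchable G.endSet {b} :=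
      (hind _ (by simpa)).1 ((h.indep_iff _ (by simpa)).2 (by simp))
    obtain ⟨ψ, k1, k2⟩ := hbm
    have hcard : 0 < ((W.erase x).erase (ψ b)).card := by
      have := Finset.pred_card_le_card_erase (s := W) (a := x)
      have := Finset.pred_card_le_card_erase (s := W.erase x) (a := ψ b)
      omega
    obtain ⟨v, hv⟩ := Finset.card_pos.1 hcard
    simp only [Finset.mem_erase] at hv
    have hm := Matchable.insert k1 k2 (f := e) (v := v) (by simpa using hbe.symm)
      (hsub v hv.2.2 hv.2.1) (by simpa using hv.1.symm)
    have hpair : ({e, b} : Set α) ⊆ M.E := Set.pair_subset he hb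
    have := ((h.indep_iff _ hpair).1 ((hind _ hpair).2 hm)).2
    exact hbe (this (by simp) (by simp) hcls)
  choose m₀ hm₀ using miss
  have miss_two' : ∀ e x, ∃ v, e ∈ M.E → (∃ b ∈ M.E, b ≠ e ∧ cls b = cls e) →
      v ∈ W ∧ v ≠ x ∧ v ∉ G.endSet e := by
    intro e x
    by_cases hP : e ∈ M.E ∧ ∃ b ∈ M.E, b ≠ e ∧ cls b = cls e
    · obtain ⟨v, hv⟩ := miss_two e x hP.1 hP.2
      exact ⟨v, fun _ _ => hv⟩
    · exact ⟨x, fun h1 h2 => absurd ⟨h1, h2⟩ hP⟩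
  choose m₁ hm₁ using miss_two'
  -- `s c` is a representative of the class `c`
  have hs : ∀ c, ∃ a, ∀ e ∈ M.E, cls e = c → a ∈ M.E ∧ cls a = c := by
    intro c
    by_cases hc : ∃ a ∈ M.E, cls a = c
    · obtain ⟨a, ha⟩ := hc
      exact ⟨a, fun _ _ _ => ha⟩
    · exact ⟨f, fun e he hec => absurd ⟨e, he, hec⟩ hc⟩
  choose s hs using hs
  -- the vertex assigned to `e`
  let m : α → Fin n := fun e => if e = s (cls e) then m₀ e else m₁ e (m₀ (s (cls e)))
  have hm : ∀ e ∈ M.E, m e ∈ W ∧ m e ∉ G.endSet e := by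
    intro e he
    simp only [m]
    split_ifs with hes
    · exact hm₀ e
    · have := hm₁ e (m₀ (s (cls e))) he
        ⟨s (cls e), (hs _ e he rfl).1, fun h => hes h.symm, (hs _ e he rfl).2⟩
      exact ⟨this.1, this.2.2⟩
  have hm_ne : ∀ a ∈ M.E, ∀ b ∈ M.E, a ≠ b → cls a = cls b → m a ≠ m b := by
    have key : ∀ a ∈ M.E, ∀ b ∈ M.E, a ≠ b → cls a = cls b → a = s (cls a) → m a ≠ m b := by
      intro a ha b hb hab hcls has
      have hbs : b ≠ s (cls b) := by
        rw [← hcls, ← has]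
        exact hab.symm
      have hma : m a = m₀ a := if_pos has
      have hmb : m b = m₁ b (m₀ (s (cls b))) := if_neg hbs
      rw [hma, hmb, ← hcls, ← has]
      exact (hm₁ b (m₀ a) hb ⟨a, ha, hab, hcls⟩).2.1.symm
    intro a ha b hb hab hcls
    obtain ⟨hsE, hsc⟩ := hs (cls a) a ha rfl
    rcases h.class_le_two a ha b hb _ hsE hcls hsc.symm with h' | h' | h'
    · exact absurd h' hab
    · exact key a ha b hb hab hcls h'
    · exact (key b hb a ha hab.symm hcls.symm (by rw [← hcls]; exact h')).symm
  obtain ⟨E, hE⟩ := hfin.exists_finset_coe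
  have hE7 : E.card = 7 := by rw [← Set.ncard_coe_finset, hE, h.ncard_ground]
  have hmem : ∀ a ∈ E, a ∈ M.E := fun a ha => hE ▸ Finset.mem_coe.2 ha
  obtain ⟨v, hv, hlt⟩ := Finset.exists_lt_card_fiber_of_mul_lt_card_of_maps_to (n := 2)
    (f := m) (s := E) (t := W) (fun a ha => (hm a (hmem a ha)).1) (by omega)
  obtain ⟨T, hT, hT3⟩ := Finset.exists_subset_card_eq (Nat.succ_le_of_lt hlt)
  have hT' : ∀ a ∈ T, a ∈ M.E ∧ m a = v := fun a ha => by
    have := Finset.mem_filter.1 (hT ha)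
    exact ⟨hmem a this.1, this.2⟩
  have hTE : (T : Set α) ⊆ M.E := fun a ha => (hT' a ha).1
  have hTind : M.Indep T := by
    rw [h.indep_iff _ hTE, Set.ncard_coe_finset, hT3]
    refine ⟨le_rfl, fun a ha b hb hab => ?_⟩
    by_contra hne
    exact hm_ne a (hTE ha) b (hTE hb) hne hab ((hT' a ha).2.trans (hT' b hb).2.symm)
  have := ((hind _ hTE).1 hTind).ncard_le (W.erase v) (by
    intro e he u hu
    refine Finset.mem_coe.2 (Finset.mem_erase.2 ⟨?_, hEW e (hTE he) hu⟩)
    rintro rfl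
    have h1 := hT' e he
    exact (hm e h1.1).2 (h1.2 ▸ hu))
  rw [Set.ncard_coe_finset, hT3, Finset.card_erase_of_mem hv, hW3] at this
  omega

/-! ### Ranks, truncations and the three matroids -/

/-- The largest independent sets of `N` have `k` elements. -/
def HasRank {α : Type*} (N : Matroid α) (k : ℕ) : Prop :=
  (∃ I, N.Indep I ∧ I.ncard = k) ∧ ∀ I, N.Indep I → I.ncard ≤ k

theorem HasRank.ncard_isBase {α : Type*} [Finite α] {N : Matroid α} {k : ℕ} (h : HasRank N k)
    {B : Set α} (hB : N.IsBase B) : B.ncard = k := by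
  obtain ⟨⟨I, hI, hIk⟩, hle⟩ := h
  refine le_antisymm (hle B hB.indep) ?_
  obtain ⟨B', hB', hIB⟩ := hI.exists_isBase_superset
  rw [hB.ncard_eq_ncard_of_isBase hB', ← hIk]
  exact Set.ncard_le_ncard hIB B'.toFinite

theorem HasRank.isBase_iff {α : Type*} [Finite α] {N : Matroid α} {k : ℕ} (h : HasRank N k)
    {I : Set α} (hI : N.Indep I) : N.IsBase I ↔ I.ncard = k := by
  refine ⟨fun hB => h.ncard_isBase hB, fun hk => ?_⟩
  obtain ⟨B, hB, hIB⟩ := hI.exists_isBase_superset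
  rwa [Set.eq_of_subset_of_ncard_le hIB (by rw [h.ncard_isBase hB, hk]) B.toFinite]

theorem HasRank.eRank_toNat {α : Type*} [Finite α] {N : Matroid α} {k : ℕ} (h : HasRank N k) :
    N.eRank.toNat = k := by
  obtain ⟨B, hB⟩ := N.exists_isBase
  rw [← hB.encard_eq_eRank, ← h.ncard_isBase hB, Set.ncard]

theorem uniform_indep_iff {r n : ℕ} {I : Set (Fin n)} : (uniform r n).Indep I ↔ I.ncard ≤ r := by
  simp [uniform]

theorem hasRank_uniform {r n : ℕ} (h : r ≤ n) : HasRank (uniform r n) r := by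
  refine ⟨?_, fun I hI => uniform_indep_iff.1 hI⟩
  obtain ⟨I, -, hI⟩ := Set.exists_subset_card_eq (s := (Set.univ : Set (Fin n))) (n := r)
    (by simpa [Set.ncard_univ] using h)
  exact ⟨I, uniform_indep_iff.2 hI.le, hI⟩

theorem ncard_preimage_inl_add_inr {α β : Type*} [Finite α] [Finite β] (I : Set (α ⊕ β)) :
    (Sum.inl ⁻¹' I).ncard + (Sum.inr ⁻¹' I).ncard = I.ncard := by
  rw [← Set.ncard_image_of_injective _ (Sum.inl_injective (α := α) (β := β)),
    ← Set.ncard_image_of_injective (Sum.inr ⁻¹' I) (Sum.inr_injective (α := α) (β := β)),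
    ← Set.ncard_union_eq _ (Set.toFinite _) (Set.toFinite _)]
  · congr 1
    ext (x | x) <;> simp
  · rw [Set.disjoint_left]
    rintro _ ⟨x, -, rfl⟩ ⟨y, -, h⟩
    cases h

theorem HasRank.sum {α β : Type*} [Finite α] [Finite β] {N : Matroid α} {N' : Matroid β}
    {k k' : ℕ} (h : HasRank N k) (h' : HasRank N' k') : HasRank (N.sum N') (k + k') := by
  obtain ⟨⟨I, hI, hIk⟩, hle⟩ := h
  obtain ⟨⟨I', hI', hIk'⟩, hle'⟩ := h'
  have e1 : Sum.inl ⁻¹' (Sum.inl '' I ∪ Sum.inr '' I' : Set (α ⊕ β)) = I := by ext; simp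
  have e2 : Sum.inr ⁻¹' (Sum.inl '' I ∪ Sum.inr '' I' : Set (α ⊕ β)) = I' := by ext; simp
  refine ⟨⟨Sum.inl '' I ∪ Sum.inr '' I', ?_, ?_⟩, fun J hJ => ?_⟩
  · rw [Matroid.sum_indep_iff, e1, e2]
    exact ⟨hI, hI'⟩
  · rw [← ncard_preimage_inl_add_inr, e1, e2, hIk, hIk']
  · rw [Matroid.sum_indep_iff] at hJ
    rw [← ncard_preimage_inl_add_inr]
    exact Nat.add_le_add (hle _ hJ.1) (hle' _ hJ.2)

theorem freeExtension_indep_iff {α : Type*} [Finite α] {N : Matroid α} {I : Set (Option α)} :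
    (freeExtension N).Indep I ↔
      N.Indep (some ⁻¹' I) ∧ (none ∈ I → ¬ N.IsBase (some ⁻¹' I)) := by
  simp [freeExtension]

theorem truncation_indep_iff {α : Type*} [Finite α] {N : Matroid α} {k : ℕ}
    (h : HasRank N (k + 1)) {I : Set α} : (truncation N).Indep I ↔ N.Indep I ∧ I.ncard ≤ k := by
  have hnone : (freeExtension N).Indep {none} := by
    rw [freeExtension_indep_iff]
    have : some ⁻¹' ({none} : Set (Option α)) = ∅ := by ext; simp
    rw [this, h.isBase_iff N.empty_indep]
    simp
  have hpre : some ⁻¹' (some '' I ∪ {none}) = I := by ext; simp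
  rw [truncation, Matroid.comap_indep_iff, hnone.contract_indep_iff, freeExtension_indep_iff, hpre,
    and_iff_left (Option.some_injective α).injOn, and_iff_right (by simp)]
  refine and_congr_right fun hI => ?_
  rw [h.isBase_iff hI]
  have := h.2 I hI
  simp only [Set.mem_union, Set.mem_singleton_iff, or_true, forall_const]
  omega

theorem truncation_ground {α : Type*} [Finite α] (N : Matroid α) : (truncation N).E = N.E := by
  ext x
  simp [truncation, freeExtension]

theorem HasRank.truncation {α : Type*} [Finite α] {N : Matroid α} {k : ℕ}
    (h : HasRank N (k + 1)) : HasRank (truncation N) k := by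
  refine ⟨?_, fun I hI => ((truncation_indep_iff h).1 hI).2⟩
  obtain ⟨I, hI, hIk⟩ := h.1
  obtain ⟨J, hJI, hJ⟩ := Set.exists_subset_card_eq (s := I) (n := k) (by omega)
  exact ⟨J, (truncation_indep_iff h).2 ⟨hI.subset hJI, hJ.le⟩, hJ⟩

theorem truncationTo_indep_iff {α : Type*} [Finite α] {N : Matroid α} {n k : ℕ}
    (h : HasRank N (n + k)) {I : Set α} :
    (truncationTo n N).Indep I ↔ N.Indep I ∧ I.ncard ≤ n := by
  rw [truncationTo, h.eRank_toNat, Nat.add_sub_cancel_left]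
  induction k generalizing N with
  | zero => exact ⟨fun hI => ⟨hI, h.2 I hI⟩, fun hI => hI.1⟩
  | succ k ih =>
    rw [Function.iterate_succ_apply, ih h.truncation, truncation_indep_iff h]
    constructor
    · exact fun hI => ⟨hI.1.1, hI.2⟩
    · exact fun hI => ⟨⟨hI.1, hI.2.trans (Nat.le_add_right _ _)⟩, hI.2⟩

theorem truncationTo_ground {α : Type*} [Finite α] (n : ℕ) (N : Matroid α) :
    (truncationTo n N).E = N.E := by
  rw [truncationTo]
  induction N.eRank.toNat - n generalizing N with
  | zero => rfl
  | succ k ih => rw [Function.iterate_succ_apply, ih, truncation_ground]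

theorem uniform_ground (r n : ℕ) : (uniform r n).E = Set.univ := rfl

theorem isDoubledUniform_uniform : IsDoubledUniform (uniform 3 7) Fin.val := by
  refine ⟨?_, fun I _ => ?_, fun a _ b _ c _ hab _ => Or.inl (Fin.ext hab)⟩
  · simp [uniform_ground, Set.ncard_univ]
  · rw [uniform_indep_iff, and_iff_left Fin.val_injective.injOn]

/-- The classes of `U_{1,2} ⊕ U_{3,5}`: the two elements of `U_{1,2}` are parallel. -/
def clsSum : Fin 2 ⊕ Fin 5 → ℕ := Sum.elim (fun _ => 0) (fun i => i + 1)

/-- The classes of `U_{1,2} ⊕ U_{1,2} ⊕ U_{3,3}`. -/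
def clsSum' : (Fin 2 ⊕ Fin 2) ⊕ Fin 3 → ℕ :=
  Sum.elim (Sum.elim (fun _ => 0) (fun _ => 1)) (fun i => i + 2)

theorem isDoubledUniform_truncationTo_sum :
    IsDoubledUniform (truncationTo 3 ((uniform 1 2).sum (uniform 3 5))) clsSum := by
  have hr : HasRank ((uniform 1 2).sum (uniform 3 5)) (3 + 1) :=
    (hasRank_uniform (by norm_num)).sum (hasRank_uniform (by norm_num))
  have hE : (truncationTo 3 ((uniform 1 2).sum (uniform 3 5))).E = Set.univ := by
    rw [truncationTo_ground]
    ext (x | x) <;> simp [uniform_ground]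
  refine ⟨by simp [hE, Set.ncard_univ], fun I _ => ?_, ?_⟩
  · rw [truncationTo_indep_iff hr, Matroid.sum_indep_iff, uniform_indep_iff, uniform_indep_iff,
      and_comm]
    refine and_congr_right fun hI => ?_
    have := ncard_preimage_inl_add_inr I
    rw [and_iff_left (by omega), Set.ncard_le_one]
    constructor
    · rintro h (x | x) hx (y | y) hy hxy
      · rw [h x hx y hy]
      · simp [clsSum] at hxy
      · simp [clsSum] at hxy
      · simp [clsSum] at hxy
        rw [Fin.ext hxy]
    · intro h x hx y hy
      simpa using h hx hy (by simp [clsSum])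
  · have : ∀ a b c : Fin 2 ⊕ Fin 5, clsSum a = clsSum b → clsSum a = clsSum c →
        a = b ∨ a = c ∨ b = c := by decide
    exact fun a _ b _ c _ => this a b c

theorem isDoubledUniform_truncationTo_sum_sum :
    IsDoubledUniform (truncationTo 3 (((uniform 1 2).sum (uniform 1 2)).sum (uniform 3 3)))
      clsSum' := by
  have hr : HasRank (((uniform 1 2).sum (uniform 1 2)).sum (uniform 3 3)) (3 + 2) :=
    ((hasRank_uniform (by norm_num)).sum (hasRank_uniform (by norm_num))).sum
      (hasRank_uniform (by norm_num))
  have hE : (truncationTo 3 (((uniform 1 2).sum (uniform 1 2)).sum (uniform 3 3))).E =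
      Set.univ := by
    rw [truncationTo_ground]
    ext ((x | x) | x) <;> simp [uniform_ground]
  refine ⟨by simp [hE, Set.ncard_univ], fun I _ => ?_, ?_⟩
  · rw [truncationTo_indep_iff hr, Matroid.sum_indep_iff, Matroid.sum_indep_iff, uniform_indep_iff,
      uniform_indep_iff, uniform_indep_iff, and_comm]
    refine and_congr_right fun hI => ?_
    have := ncard_preimage_inl_add_inr I
    rw [and_iff_left (by omega), Set.ncard_le_one, Set.ncard_le_one]
    constructor
    · rintro ⟨h, h'⟩ ((x | x) | x) hx ((y | y) | y) hy hxy
      · rw [h x hx y hy]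
      · simp [clsSum'] at hxy
      · simp [clsSum'] at hxy
      · simp [clsSum'] at hxy
      · rw [h' x hx y hy]
      · simp [clsSum'] at hxy
      · simp [clsSum'] at hxy
      · simp [clsSum'] at hxy
      · simp [clsSum'] at hxy
        rw [Fin.ext hxy]
    · intro h
      exact ⟨fun x hx y hy => by simpa using h hx hy (by simp [clsSum']),
        fun x hx y hy => by simpa using h hx hy (by simp [clsSum'])⟩
  · have : ∀ a b c : (Fin 2 ⊕ Fin 2) ⊕ Fin 3, clsSum' a = clsSum' b → clsSum' a = clsSum' c →
        a = b ∨ a = c ∨ b = c := by decide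
    exact fun a _ b _ c _ => this a b c

/-! ### Lattice path matroids of rank at most three -/

/-- A lattice path matroid has a presentation by intervals. Here `p` and `q` are the heights of
the lower and the upper bounding path, and `f` labels the elements by their positions. A step
to the north from height `v` is possible at position `s` exactly if `v` is at least the height
`p s` of the lower path before the step and less than the height `q (s + 1)` of the upper
path after it. -/
theorem IsLatticePathMatroid.exists_isPresentation {α : Type*} {M : Matroid α}
    (hM : IsLatticePathMatroid M) : ∃ (n r : ℕ) (p q : ℕ → ℕ) (f : α → ℕ),
      (∀ i < n, ∃ e ∈ M.E, f e = i) ∧ Monotone p ∧ Monotone q ∧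
      q 0 = 0 ∧ p n = r ∧ q n = r ∧ (∀ k, p (k + 1) ≤ p k + 1) ∧ (∀ k, q (k + 1) ≤ q k + 1) ∧
      Set.InjOn f M.E ∧
      (∀ e ∈ M.E, f e < n) ∧ IsPresentation M r (fun e => Finset.Ico (p (f e)) (q (f e + 1))) := by
  obtain ⟨n, P, Q, f, hfin, hf, hsurj, hfn, hPQ, -, hbase⟩ := hM.exists_labelling
  refine ⟨n, P.height n, P.height, Q.height, f, hsurj, P.height_mono, Q.height_mono,
    countBelow_zero, rfl, hPQ.symm,
    countBelow_succ_le (Set.toFinite _) Fin.val_injective.injOn,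
    countBelow_succ_le (Set.toFinite _) Fin.val_injective.injOn, hf, hfn, hfin, ?_, ?_⟩
  · intro e he v hv
    rw [hPQ]
    exact (Finset.mem_Ico.1 hv).2.trans_le (Q.height_mono (hfn e he))
  · intro B hB
    rw [hbase B hB]
    refine and_congr_right fun hBr => ?_
    have hBfin := hfin.subset hB
    constructor
    · intro h
      refine ⟨fun b => countBelow f B (f b), ?_, fun b hb => ?_⟩
      · have key : ∀ a ∈ B, ∀ b ∈ B, f a < f b → countBelow f B (f a) < countBelow f B (f b) := by
          intro a ha b hb hab
          have h1 := countBelow_succ_of_mem hBfin (hf.mono hB) ha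
          have h2 := countBelow_mono (f := f) hBfin (show f a + 1 ≤ f b from hab)
          omega
        intro a ha b hb hab
        rcases lt_trichotomy (f a) (f b) with h | h | h
        · exact absurd hab (key a ha b hb h).ne
        · exact hf (hB ha) (hB hb) h
        · exact absurd hab.symm (key b hb a ha h).ne
      · have h1 := hfn b (hB hb)
        have h2 := countBelow_succ_of_mem hBfin (hf.mono hB) hb
        simp only [Finset.coe_Ico, Set.mem_Ico]
        refine ⟨(h _ h1.le).1, ?_⟩
        have := (h (f b + 1) h1).2
        omega
    · rintro ⟨φ, h1, h2⟩ k hk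
      have hlow : (φ '' {b ∈ B | f b < k}).ncard ≤ (Set.Iio (Q.height k)).ncard := by
        refine Set.ncard_le_ncard ?_ (Set.finite_Iio _)
        rintro _ ⟨b, ⟨hb, hbk⟩, rfl⟩
        have := h2 b hb
        simp only [Finset.coe_Ico, Set.mem_Ico] at this
        exact this.2.trans_le (Q.height_mono hbk)
      have hhigh : (φ '' {b ∈ B | ¬ f b < k}).ncard ≤
          ((Finset.Ico (P.height k) (P.height n) : Finset ℕ) : Set ℕ).ncard := by
        refine Set.ncard_le_ncard ?_ (Finset.finite_toSet _)
        rintro _ ⟨b, ⟨hb, hbk⟩, rfl⟩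
        have := h2 b hb
        simp only [Finset.coe_Ico, Set.mem_Ico] at this
        rw [Finset.coe_Ico, Set.mem_Ico]
        refine ⟨(P.height_mono (not_lt.1 hbk)).trans this.1, ?_⟩
        rw [hPQ]
        exact this.2.trans_le (Q.height_mono (hfn b (hB hb)))
      rw [(h1.mono (Set.sep_subset _ _)).ncard_image] at hlow hhigh
      rw [Set.ncard_coe_finset, Nat.card_Ico] at hhigh
      have hIio : (Set.Iio (Q.height k)).ncard = Q.height k := by simp
      rw [hIio] at hlow
      have hsum : {b ∈ B | f b < k}.ncard + {b ∈ B | ¬ f b < k}.ncard = B.ncard := by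
        rw [← Set.ncard_union_eq _ (hBfin.subset (Set.sep_subset _ _))
          (hBfin.subset (Set.sep_subset _ _))]
        · congr 1
          ext b
          simp only [Set.mem_union, Set.mem_ofPred_eq]
          tauto
        · rw [Set.disjoint_left]
          rintro b ⟨-, hb⟩ ⟨-, hb'⟩
          exact hb' hb
      have := P.height_mono hk
      refine ⟨?_, hlow⟩
      rw [countBelow]
      omega

/-- Three finite sets have distinct representatives. -/
def TripleMatch (S T U : Finset ℕ) : Prop :=
  ∃ i ∈ S, ∃ j ∈ T, ∃ k ∈ U, i ≠ j ∧ i ≠ k ∧ j ≠ k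

instance (S T U : Finset ℕ) : Decidable (TripleMatch S T U) := by
  unfold TripleMatch
  infer_instance

theorem matchable_triple_iff {α : Type*} {A : α → Finset ℕ} {a b c : α} (hab : a ≠ b)
    (hac : a ≠ c) (hbc : b ≠ c) :
    Matchable (fun e => (A e : Set ℕ)) {a, b, c} ↔ TripleMatch (A a) (A b) (A c) := by
  classical
  constructor
  · rintro ⟨φ, h1, h2⟩
    exact ⟨φ a, h2 a (by simp), φ b, h2 b (by simp), φ c, h2 c (by simp),
      fun h => hab (h1 (by simp) (by simp) h), fun h => hac (h1 (by simp) (by simp) h),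
      fun h => hbc (h1 (by simp) (by simp) h)⟩
  · rintro ⟨i, hi, j, hj, k, hk, hij, hik, hjk⟩
    obtain ⟨φ, ha, hb, hc⟩ : ∃ φ : α → ℕ, φ a = i ∧ φ b = j ∧ φ c = k :=
      ⟨fun e => if e = a then i else if e = b then j else k, by simp, by simp [hab.symm],
        by simp [hac.symm, hbc.symm]⟩
    refine ⟨φ, ?_, ?_⟩
    · rintro x (rfl | rfl | rfl) y (rfl | rfl | rfl) hxy <;> first | rfl | omega
    · rintro x (rfl | rfl | rfl)
      · rwa [ha]
      · rwa [hb]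
      · rwa [hc]

/-- In rank three, the sets of a presentation can be changed as long as the same triples
keep having distinct representatives. -/
theorem IsPresentation.congr_triple {α : Type*} {M : Matroid α} {A A' : α → Finset ℕ}
    (h : IsPresentation M 3 A) (hlt : ∀ e ∈ M.E, ∀ v ∈ A' e, v < 3)
    (hA : ∀ a ∈ M.E, ∀ b ∈ M.E, ∀ c ∈ M.E, a ≠ b → a ≠ c → b ≠ c →
      (TripleMatch (A a) (A b) (A c) ↔ TripleMatch (A' a) (A' b) (A' c))) :
    IsPresentation M 3 A' := by
  refine ⟨h.finite, hlt, fun B hB => ?_⟩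
  rw [h.isBase_iff B hB]
  refine and_congr_right fun hB3 => ?_
  obtain ⟨a, b, c, hab, hac, hbc, rfl⟩ := Set.ncard_eq_three.1 hB3
  rw [matchable_triple_iff hab hac hbc, matchable_triple_iff hab hac hbc]
  exact hA a (hB (by simp)) b (hB (by simp)) c (hB (by simp)) hab hac hbc

/-- Seven elements of a presented matroid whose sets have the right systems of distinct
representatives span a given doubled uniform matroid. -/
theorem IsPresentation.isIsoTo_restrict {α β : Type*} [Finite β] {M : Matroid α}
    {A : α → Finset ℕ} {N : Matroid β} {cls : β → ℕ} (hM : IsPresentation M 3 A)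
    (hN : IsDoubledUniform N cls) (hNE : N.E = Set.univ) {g : β → α} {τ : β → Finset ℕ}
    (hτ : ∀ i, A (g i) = τ i) (hg' : ∀ i j, τ i = τ j → i ≠ j → g i ≠ g j)
    (hgE : ∀ i, g i ∈ M.E)
    (hpair : ∀ i j, i ≠ j → cls i = cls j → (τ i ∪ τ j).card ≤ 1)
    (htriple : ∀ i j k, cls i ≠ cls j → cls i ≠ cls k → cls j ≠ cls k →
      TripleMatch (τ i) (τ j) (τ k))
    (hthird : ∀ i j, ∃ k, cls k ≠ cls i ∧ cls k ≠ cls j) :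
    ∃ S ⊆ M.E, IsIsoTo (M.restrict S) N := by
  classical
  have hg : Function.Injective g := by
    intro i j hij
    by_contra hne
    exact hg' i j (by rw [← hτ, ← hτ, hij]) hne hij
  have key : ∀ I : Set β, M.Indep (g '' I) ↔ N.Indep I := by
    intro I
    have hIE : g '' I ⊆ M.E := by
      rintro _ ⟨i, -, rfl⟩
      exact hgE i
    rw [hM.indep_iff hIE, hN.indep_iff I (by simp [hNE])]
    constructor
    · intro hI
      refine ⟨?_, fun i hi j hj hij => ?_⟩
      · have := hI.ncard_le (Finset.range 3) fun e he v hv =>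
          Finset.mem_coe.2 (Finset.mem_range.2 (hM.lt e (hIE he) v hv))
        rwa [Set.ncard_image_of_injective _ hg, Finset.card_range] at this
      · by_contra hne
        obtain ⟨φ, h1, h2⟩ := hI
        have hi' := h2 _ ⟨i, hi, rfl⟩
        have hj' := h2 _ ⟨j, hj, rfl⟩
        have := Finset.card_le_one.1 (hpair i j hne hij) _
          (Finset.mem_union_left _ (by rw [← hτ]; exact hi')) _
          (Finset.mem_union_right _ (by rw [← hτ]; exact hj'))
        exact hne (hg (h1 ⟨i, hi, rfl⟩ ⟨j, hj, rfl⟩ this))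
    · rintro ⟨h3, hinj⟩
      have htr : ∀ i j k, cls i ≠ cls j → cls i ≠ cls k → cls j ≠ cls k →
          Matchable (fun e => (A e : Set ℕ)) (g '' {i, j, k}) := by
        intro i j k hij hik hjk
        have ne : ∀ {x y}, cls x ≠ cls y → g x ≠ g y := fun h h' => h (congrArg cls (hg h'))
        rw [Set.image_insert_eq, Set.image_pair, matchable_triple_iff (ne hij) (ne hik) (ne hjk),
          hτ, hτ, hτ]
        exact htriple i j k hij hik hjk
      suffices ∃ i j k, cls i ≠ cls j ∧ cls i ≠ cls k ∧ cls j ≠ cls k ∧ I ⊆ {i, j, k} by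
        obtain ⟨i, j, k, hij, hik, hjk, hsub⟩ := this
        exact (htr i j k hij hik hjk).mono (Set.image_mono hsub)
      have hβ : Nonempty β := by
        obtain ⟨i, hi⟩ := Set.nonempty_of_ncard_ne_zero (s := N.E) (by rw [hN.ncard_ground]; simp)
        exact ⟨i⟩
      have two : ∀ i j, cls i ≠ cls j → I ⊆ {i, j} →
          ∃ i j k, cls i ≠ cls j ∧ cls i ≠ cls k ∧ cls j ≠ cls k ∧ I ⊆ {i, j, k} := by
        intro i j hij hsub
        obtain ⟨k, hki, hkj⟩ := hthird i j
        exact ⟨i, j, k, hij, hki.symm, hkj.symm, hsub.trans (by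
          rintro x (rfl | rfl) <;> simp)⟩
      have one : ∀ i, I ⊆ {i} →
          ∃ i j k, cls i ≠ cls j ∧ cls i ≠ cls k ∧ cls j ≠ cls k ∧ I ⊆ {i, j, k} := by
        intro i hsub
        obtain ⟨k, hki, -⟩ := hthird i i
        exact two i k hki.symm (hsub.trans (by simp))
      have hcases : I.ncard = 0 ∨ I.ncard = 1 ∨ I.ncard = 2 ∨ I.ncard = 3 := by omega
      rcases hcases with h | h | h | h
      · rw [Set.ncard_eq_zero] at h
        obtain ⟨i⟩ := hβ
        exact one i (by simp [h])
      · obtain ⟨i, rfl⟩ := Set.ncard_eq_one.1 h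
        exact one i Set.Subset.rfl
      · obtain ⟨i, j, hij, rfl⟩ := Set.ncard_eq_two.1 h
        exact two i j (fun h => hij (hinj (by simp) (by simp) h)) Set.Subset.rfl
      · obtain ⟨i, j, k, hij, hik, hjk, rfl⟩ := Set.ncard_eq_three.1 h
        exact ⟨i, j, k, fun h => hij (hinj (by simp) (by simp) h),
          fun h => hik (hinj (by simp) (by simp) h), fun h => hjk (hinj (by simp) (by simp) h),
          Set.Subset.rfl⟩
  refine ⟨Set.range g, by rintro _ ⟨i, rfl⟩; exact hgE i, ?_⟩
  let e : (M.restrict (Set.range g)).E ≃ N.E :=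
    (Equiv.ofInjective g hg).symm.trans ((Equiv.Set.univ β).symm.trans (Equiv.setCongr hNE.symm))
  have he : ∀ x : (M.restrict (Set.range g)).E, g (e x) = x := fun x =>
    Equiv.apply_ofInjective_symm hg x
  refine ⟨e, fun I => ?_⟩
  rw [← key, Set.image_image, Set.image_image, Matroid.restrict_indep_iff,
    and_iff_left (by rintro _ ⟨x, -, rfl⟩; exact x.2)]
  simp only [he]

/-- The sets that occur in the presentation of a rank-three lattice path matroid in which some
element can be any of the three north steps. -/
def intervalTypes : Finset (Finset ℕ) := {∅, {0}, {0, 1}, {0, 1, 2}, {1, 2}, {2}}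

/-- A new assignment of sets: optionally `{0}` is enlarged to `{0, 1}`, optionally `{2}`
is enlarged to `{1, 2}`, and `{0, 1, 2}` is replaced by `{0, 2}`. In terms of graphs, `0`, `1`, `2`
are the vertices of a triangle, the elements that can be any north step become edges
between `0` and `2`, and a loop at `0` or `2`, if it is the only one there, can become a link to `1`. -/
def reassign (l r : Bool) (S : Finset ℕ) : Finset ℕ :=
  if S = {0} ∧ l then {0, 1} else if S = {2} ∧ r then {1, 2} else
  if S = {0, 1, 2} then {0, 2} else S

/-- At most one of the three sets equals `X`. -/
def AtMostOnce (X S T U : Finset ℕ) : Prop :=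
  ¬ (S = X ∧ T = X) ∧ ¬ (S = X ∧ U = X) ∧ ¬ (T = X ∧ U = X)

instance (X S T U : Finset ℕ) : Decidable (AtMostOnce X S T U) := by
  unfold AtMostOnce
  infer_instance

/-- The reassignment is harmless if only one element has the set `{0}`, and only one `{0, 1, 2}`. -/
theorem tripleMatch_reassign_left : ∀ S ∈ intervalTypes, ∀ T ∈ intervalTypes,
    ∀ U ∈ intervalTypes, AtMostOnce {0} S T U ∧ AtMostOnce {0, 1, 2} S T U →
      (TripleMatch S T U ↔ TripleMatch (reassign true false S) (reassign true false T)
        (reassign true false U)) := by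
  decide

theorem tripleMatch_reassign_right : ∀ S ∈ intervalTypes, ∀ T ∈ intervalTypes,
    ∀ U ∈ intervalTypes, AtMostOnce {2} S T U ∧ AtMostOnce {0, 1, 2} S T U →
      (TripleMatch S T U ↔ TripleMatch (reassign false true S) (reassign false true T)
        (reassign false true U)) := by
  decide

/-- If both `{0}` and `{2}` belong to only one element, then two elements may have the
set `{0, 1, 2}`. -/
theorem tripleMatch_reassign_both : ∀ S ∈ intervalTypes, ∀ T ∈ intervalTypes,
    ∀ U ∈ intervalTypes, AtMostOnce {0} S T U ∧ AtMostOnce {2} S T U ∧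
      ¬ (S = {0, 1, 2} ∧ T = {0, 1, 2} ∧ U = {0, 1, 2}) →
      (TripleMatch S T U ↔ TripleMatch (reassign true true S) (reassign true true T)
        (reassign true true U)) := by
  decide

theorem IsPresentation.isBicircularMatroid_of_reassign {α : Type*} {M : Matroid α}
    {A : α → Finset ℕ} (hM : IsPresentation M 3 A) (hA : ∀ e ∈ M.E, A e ∈ intervalTypes)
    {l r : Bool} {D : Finset ℕ → Finset ℕ → Finset ℕ → Prop}
    (h : ∀ S ∈ intervalTypes, ∀ T ∈ intervalTypes, ∀ U ∈ intervalTypes, D S T U →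
      (TripleMatch S T U ↔ TripleMatch (reassign l r S) (reassign l r T) (reassign l r U)))
    (hD : ∀ a ∈ M.E, ∀ b ∈ M.E, ∀ c ∈ M.E, a ≠ b → a ≠ c → b ≠ c → D (A a) (A b) (A c)) :
    IsBicircularMatroid M := by
  have hsmall : ∀ l r : Bool, ∀ S ∈ intervalTypes,
      (∀ v ∈ reassign l r S, v < 3) ∧ (reassign l r S).card ≤ 2 := by decide
  refine (hM.congr_triple (A' := fun e => reassign l r (A e))
    (fun e he => (hsmall l r _ (hA e he)).1) fun a ha b hb c hc hab hac hbc => ?_)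
    |>.isBicircularMatroid fun e he => (hsmall l r _ (hA e he)).2
  exact h _ (hA a ha) _ (hA b hb) _ (hA c hc) (hD a ha b hb c hc hab hac hbc)

theorem atMostOnce_of_unique {α : Type*} {E : Set α} {A : α → Finset ℕ} {X : Finset ℕ}
    (h : ∀ a ∈ E, ∀ b ∈ E, A a = X → A b = X → a = b) {a b c : α} (ha : a ∈ E) (hb : b ∈ E)
    (hc : c ∈ E) (hab : a ≠ b) (hac : a ≠ c) (hbc : b ≠ c) :
    AtMostOnce X (A a) (A b) (A c) :=
  ⟨fun h' => hab (h a ha b hb h'.1 h'.2), fun h' => hac (h a ha c hc h'.1 h'.2),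
    fun h' => hbc (h b hb c hc h'.1 h'.2)⟩

/-- Suppose that all five intervals occur, and consider the numbers of elements with
the sets `{0}`, `{0, 1, 2}` and `{2}`. If these are large enough, then seven elements can be chosen
that form one of the three excluded minors. Otherwise, `reassign` turns the presentation into one
by sets with at most two members. -/
theorem IsPresentation.isBicircularMatroid_or_exists_isIsoTo {α : Type*} {M : Matroid α}
    {A : α → Finset ℕ} (hM : IsPresentation M 3 A) (hA : ∀ e ∈ M.E, A e ∈ intervalTypes)
    {x y t z w : α} (hx : x ∈ M.E) (hy : y ∈ M.E) (ht : t ∈ M.E) (hz : z ∈ M.E) (hw : w ∈ M.E)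
    (hxA : A x = {0}) (hyA : A y = {0, 1}) (htA : A t = {0, 1, 2}) (hzA : A z = {1, 2})
    (hwA : A w = {2}) : IsBicircularMatroid M ∨ ∃ S ⊆ M.E,
      IsIsoTo (M.restrict S) (uniform 3 7) ∨
      IsIsoTo (M.restrict S) (truncationTo 3 ((uniform 1 2).sum (uniform 3 5))) ∨
      IsIsoTo (M.restrict S)
        (truncationTo 3 (((uniform 1 2).sum (uniform 1 2)).sum (uniform 3 3))) := by
  have hE2 : (truncationTo 3 ((uniform 1 2).sum (uniform 3 5))).E = Set.univ := by
    rw [truncationTo_ground]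
    ext (x | x) <;> simp [uniform_ground]
  have hE3 : (truncationTo 3 (((uniform 1 2).sum (uniform 1 2)).sum (uniform 3 3))).E =
      Set.univ := by
    rw [truncationTo_ground]
    ext ((x | x) | x) <;> simp [uniform_ground]
  by_cases h1 : ∃ t₁ ∈ M.E, ∃ t₂ ∈ M.E, ∃ t₃ ∈ M.E, A t₁ = {0, 1, 2} ∧ A t₂ = {0, 1, 2} ∧
      A t₃ = {0, 1, 2} ∧ t₁ ≠ t₂ ∧ t₁ ≠ t₃ ∧ t₂ ≠ t₃
  · obtain ⟨t₁, m1, t₂, m2, t₃, m3, a1, a2, a3, h12, h13, h23⟩ := h1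
    right
    obtain ⟨S, hS, hiso⟩ := hM.isIsoTo_restrict isDoubledUniform_uniform (uniform_ground _ _)
      (g := ![t₁, t₂, t₃, x, y, z, w])
      (τ := ![{0, 1, 2}, {0, 1, 2}, {0, 1, 2}, {0}, {0, 1}, {1, 2}, {2}])
      (by simp [Fin.forall_fin_succ, *])
      (by
        have : ∀ i j, (![{0, 1, 2}, {0, 1, 2}, {0, 1, 2}, {0}, {0, 1}, {1, 2}, {2}] :
            Fin 7 → Finset ℕ) i = ![{0, 1, 2}, {0, 1, 2}, {0, 1, 2}, {0}, {0, 1}, {1, 2}, {2}] j →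
            i ≠ j → i = 0 ∧ j = 1 ∨ i = 1 ∧ j = 0 ∨ i = 0 ∧ j = 2 ∨ i = 2 ∧ j = 0 ∨
              i = 1 ∧ j = 2 ∨ i = 2 ∧ j = 1 := by decide
        intro i j h hne
        rcases this i j h hne with ⟨rfl, rfl⟩ | ⟨rfl, rfl⟩ | ⟨rfl, rfl⟩ | ⟨rfl, rfl⟩ |
          ⟨rfl, rfl⟩ | ⟨rfl, rfl⟩
        exacts [h12, h12.symm, h13, h13.symm, h23, h23.symm])
      (by simp [Fin.forall_fin_succ, *]) (by decide) (by decide) (by decide)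
    exact ⟨S, hS, Or.inl hiso⟩
  by_cases h2 : ∃ t₁ ∈ M.E, ∃ t₂ ∈ M.E, A t₁ = {0, 1, 2} ∧ A t₂ = {0, 1, 2} ∧ t₁ ≠ t₂
  · obtain ⟨t₁, m1, t₂, m2, a1, a2, h12⟩ := h2
    -- two elements with the set `{0}`, or, symmetrically, two with the set `{2}`
    have htwo : ∀ S S' : Finset ℕ, S = {0} ∧ S' = {2} ∨ S = {2} ∧ S' = {0} →
        ∀ x₁ ∈ M.E, ∀ x₂ ∈ M.E, A x₁ = S → A x₂ = S → x₁ ≠ x₂ → ∀ w ∈ M.E, A w = S' →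
        ∃ S ⊆ M.E, IsIsoTo (M.restrict S)
          (truncationTo 3 ((uniform 1 2).sum (uniform 3 5))) := by
      intro S S' hS x₁ hx₁ x₂ hx₂ b1 b2 hne w hw hwA
      refine hM.isIsoTo_restrict isDoubledUniform_truncationTo_sum hE2
        (g := Sum.elim ![x₁, x₂] ![t₁, t₂, y, z, w])
        (τ := Sum.elim ![S, S] ![{0, 1, 2}, {0, 1, 2}, {0, 1}, {1, 2}, S'])
        (by rintro (i | i) <;> fin_cases i <;> simp [*]) ?_
        (by rintro (i | i) <;> fin_cases i <;> simp [*]) ?_ ?_ (by decide)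
      · have : ∀ i j : Fin 2 ⊕ Fin 5, (Sum.elim ![S, S] ![{0, 1, 2}, {0, 1, 2}, {0, 1}, {1, 2}, S'] :
            Fin 2 ⊕ Fin 5 → Finset ℕ) i =
              Sum.elim ![S, S] ![{0, 1, 2}, {0, 1, 2}, {0, 1}, {1, 2}, S'] j →
            i ≠ j → i = .inl 0 ∧ j = .inl 1 ∨ i = .inl 1 ∧ j = .inl 0 ∨
              i = .inr 0 ∧ j = .inr 1 ∨ i = .inr 1 ∧ j = .inr 0 := by
          rcases hS with ⟨rfl, rfl⟩ | ⟨rfl, rfl⟩ <;> decide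
        intro i j h hij
        rcases this i j h hij with ⟨rfl, rfl⟩ | ⟨rfl, rfl⟩ | ⟨rfl, rfl⟩ | ⟨rfl, rfl⟩
        exacts [hne, hne.symm, h12, h12.symm]
      · rcases hS with ⟨rfl, rfl⟩ | ⟨rfl, rfl⟩ <;> decide
      · rcases hS with ⟨rfl, rfl⟩ | ⟨rfl, rfl⟩ <;> decide
    by_cases h3 : ∃ x₁ ∈ M.E, ∃ x₂ ∈ M.E, A x₁ = {0} ∧ A x₂ = {0} ∧ x₁ ≠ x₂
    · obtain ⟨x₁, hx₁, x₂, hx₂, b1, b2, hne⟩ := h3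
      obtain ⟨S, hS, hiso⟩ := htwo _ _ (Or.inl ⟨rfl, rfl⟩) x₁ hx₁ x₂ hx₂ b1 b2 hne w hw hwA
      exact Or.inr ⟨S, hS, Or.inr (Or.inl hiso)⟩
    by_cases h4 : ∃ w₁ ∈ M.E, ∃ w₂ ∈ M.E, A w₁ = {2} ∧ A w₂ = {2} ∧ w₁ ≠ w₂
    · obtain ⟨w₁, hw₁, w₂, hw₂, b1, b2, hne⟩ := h4
      obtain ⟨S, hS, hiso⟩ := htwo _ _ (Or.inr ⟨rfl, rfl⟩) w₁ hw₁ w₂ hw₂ b1 b2 hne x hx hxA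
      exact Or.inr ⟨S, hS, Or.inr (Or.inl hiso)⟩
    refine Or.inl (hM.isBicircularMatroid_of_reassign hA tripleMatch_reassign_both
      fun a ha b hb c hc hab hac hbc => ⟨?_, ?_, ?_⟩)
    · refine atMostOnce_of_unique (fun u hu v hv h h' => ?_) ha hb hc hab hac hbc
      by_contra hne
      exact h3 ⟨u, hu, v, hv, h, h', hne⟩
    · refine atMostOnce_of_unique (fun u hu v hv h h' => ?_) ha hb hc hab hac hbc
      by_contra hne
      exact h4 ⟨u, hu, v, hv, h, h', hne⟩
    · rintro ⟨h, h', h''⟩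
      exact h1 ⟨a, ha, b, hb, c, hc, h, h', h'', hab, hac, hbc⟩
  have ht1 : ∀ u ∈ M.E, ∀ v ∈ M.E, A u = {0, 1, 2} → A v = {0, 1, 2} → u = v := by
    intro u hu v hv h h'
    by_contra hne
    exact h2 ⟨u, hu, v, hv, h, h', hne⟩
  by_cases h3 : ∃ x₁ ∈ M.E, ∃ x₂ ∈ M.E, A x₁ = {0} ∧ A x₂ = {0} ∧ x₁ ≠ x₂
  · by_cases h4 : ∃ w₁ ∈ M.E, ∃ w₂ ∈ M.E, A w₁ = {2} ∧ A w₂ = {2} ∧ w₁ ≠ w₂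
    · obtain ⟨x₁, hx₁, x₂, hx₂, b1, b2, hx12⟩ := h3
      obtain ⟨w₁, hw₁, w₂, hw₂, c1, c2, hw12⟩ := h4
      obtain ⟨S, hS, hiso⟩ := hM.isIsoTo_restrict isDoubledUniform_truncationTo_sum_sum hE3
        (g := Sum.elim (Sum.elim ![x₁, x₂] ![w₁, w₂]) ![t, y, z])
        (τ := Sum.elim (Sum.elim ![{0}, {0}] ![{2}, {2}]) ![{0, 1, 2}, {0, 1}, {1, 2}])
        (by rintro ((i | i) | i) <;> fin_cases i <;> simp [*])
        (by
          have : ∀ i j : (Fin 2 ⊕ Fin 2) ⊕ Fin 3, (Sum.elim (Sum.elim ![{0}, {0}] ![{2}, {2}])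
                ![{0, 1, 2}, {0, 1}, {1, 2}] : (Fin 2 ⊕ Fin 2) ⊕ Fin 3 → Finset ℕ) i =
                Sum.elim (Sum.elim ![{0}, {0}] ![{2}, {2}]) ![{0, 1, 2}, {0, 1}, {1, 2}] j →
              i ≠ j → i = .inl (.inl 0) ∧ j = .inl (.inl 1) ∨
                i = .inl (.inl 1) ∧ j = .inl (.inl 0) ∨
                i = .inl (.inr 0) ∧ j = .inl (.inr 1) ∨
                i = .inl (.inr 1) ∧ j = .inl (.inr 0) := by
            decide
          intro i j h hij
          rcases this i j h hij with ⟨rfl, rfl⟩ | ⟨rfl, rfl⟩ | ⟨rfl, rfl⟩ | ⟨rfl, rfl⟩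
          exacts [hx12, hx12.symm, hw12, hw12.symm])
        (by rintro ((i | i) | i) <;> fin_cases i <;> simp [*])
        (by decide) (by decide) (by decide)
      exact Or.inr ⟨S, hS, Or.inr (Or.inr hiso)⟩
    · refine Or.inl (hM.isBicircularMatroid_of_reassign hA tripleMatch_reassign_right
        fun a ha b hb c hc hab hac hbc => ⟨?_, atMostOnce_of_unique ht1 ha hb hc hab hac hbc⟩)
      refine atMostOnce_of_unique (fun u hu v hv h h' => ?_) ha hb hc hab hac hbc
      by_contra hne
      exact h4 ⟨u, hu, v, hv, h, h', hne⟩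
  · refine Or.inl (hM.isBicircularMatroid_of_reassign hA tripleMatch_reassign_left
      fun a ha b hb c hc hab hac hbc => ⟨?_, atMostOnce_of_unique ht1 ha hb hc hab hac hbc⟩)
    refine atMostOnce_of_unique (fun u hu v hv h h' => ?_) ha hb hc hab hac hbc
    by_contra hne
    exact h3 ⟨u, hu, v, hv, h, h', hne⟩

/-- A lattice path matroid of rank at most three is bicircular unless it contains one of the
three excluded minors as a restriction. -/
theorem IsLatticePathMatroid.isBicircularMatroid_or_exists_isIsoTo {α : Type*} {M : Matroid α}
    (hM : IsLatticePathMatroid M) (hr : ∀ B, M.IsBase B → B.ncard ≤ 3) :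
    IsBicircularMatroid M ∨ ∃ S ⊆ M.E,
      IsIsoTo (M.restrict S) (uniform 3 7) ∨
      IsIsoTo (M.restrict S) (truncationTo 3 ((uniform 1 2).sum (uniform 3 5))) ∨
      IsIsoTo (M.restrict S)
        (truncationTo 3 (((uniform 1 2).sum (uniform 1 2)).sum (uniform 3 3))) := by
  obtain ⟨n, r, p, q, f, hsurj, hp, hq, hq0, hpn, hqn, hp1, hq1, hf, hfn, hpres⟩ :=
    hM.exists_isPresentation
  have hr3 : r ≤ 3 := by
    obtain ⟨B, hB⟩ := M.exists_isBase
    rw [← ((hpres.isBase_iff B hB.subset_ground).1 hB).1]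
    exact hr B hB
  by_cases hsmall : ∀ e ∈ M.E, (Finset.Ico (p (f e)) (q (f e + 1))).card ≤ 2
  · exact Or.inl (hpres.isBicircularMatroid hsmall)
  push Not at hsmall
  obtain ⟨t, ht, ht3⟩ := hsmall
  rw [Nat.card_Ico] at ht3
  have hqt : q (f t + 1) ≤ r := hqn ▸ hq (hfn t ht)
  obtain rfl : r = 3 := by omega
  have hpt0 : p (f t) = 0 := by omega
  have hqt3 : q (f t + 1) = 3 := by omega
  -- the positions at which `p` or `q` increases
  have hstep : ∀ h : ℕ → ℕ, (∀ k, h (k + 1) ≤ h k + 1) → ∀ v N, h 0 ≤ v → v < h N →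
      ∃ i < N, h i = v ∧ h (i + 1) = v + 1 := by
    intro h h1 v N h0 hv
    induction N with
    | zero => omega
    | succ N ih =>
      by_cases hN : v < h N
      · obtain ⟨i, hi, h'⟩ := ih hN
        exact ⟨i, by omega, h'⟩
      · have := h1 N
        exact ⟨N, by omega, by omega, by omega⟩
  have hlow : ∀ i ≤ f t, p i = 0 := fun i hi => Nat.le_zero.1 (hpt0 ▸ hp hi)
  have hhigh : ∀ i, f t + 1 ≤ i → i ≤ n → q i = 3 := fun i hi hin =>
    le_antisymm (hqn ▸ hq hin) (hqt3 ▸ hq hi)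
  have hqstep : ∀ v < 2, ∃ e ∈ M.E, Finset.Ico (p (f e)) (q (f e + 1)) = Finset.Ico 0 (v + 1) := by
    intro v hv
    obtain ⟨i, hi, h1, h2⟩ := hstep q hq1 v (f t + 1) (by omega) (by omega)
    have hit : i ≤ f t := by omega
    obtain ⟨e, he, rfl⟩ := hsurj i (hit.trans_lt (hfn t ht))
    exact ⟨e, he, by rw [h2, hlow _ hit]⟩
  have hpstep : ∀ v, 0 < v → v < 3 → ∃ e ∈ M.E,
      Finset.Ico (p (f e)) (q (f e + 1)) = Finset.Ico v 3 := by
    intro v hv hv3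
    obtain ⟨i, hi, h1, h2⟩ := hstep p hp1 v n (by rw [hlow 0 (Nat.zero_le _)]; omega) (by omega)
    obtain ⟨e, he, rfl⟩ := hsurj i hi
    refine ⟨e, he, ?_⟩
    have : ¬ f e ≤ f t := fun h => by
      have := hlow _ h
      omega
    rw [h1, hhigh _ (by omega) hi]
  obtain ⟨x, hx, hxA⟩ := hqstep 0 (by norm_num)
  obtain ⟨y, hy, hyA⟩ := hqstep 1 (by norm_num)
  obtain ⟨z, hz, hzA⟩ := hpstep 1 (by norm_num) (by norm_num)
  obtain ⟨w, hw, hwA⟩ := hpstep 2 (by norm_num) (by norm_num)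
  refine hpres.isBicircularMatroid_or_exists_isIsoTo (fun e he => ?_) hx hy ht hz hw
    (hxA.trans (by decide)) (hyA.trans (by decide)) ?_ (hzA.trans (by decide))
    (hwA.trans (by decide))
  · have hIco : ∀ b ≤ 3, Finset.Ico 0 b ∈ intervalTypes ∧ Finset.Ico b 3 ∈ intervalTypes := by
      decide
    have hq3 : q (f e + 1) ≤ 3 := hqn ▸ hq (hfn e he)
    have hp3 : p (f e) ≤ 3 := hpn ▸ hp (hfn e he).le
    rcases le_or_gt (f e) (f t) with h | h
    · rw [hlow _ h]
      exact (hIco _ hq3).1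
    · rw [hhigh (f e + 1) (by omega) (hfn e he)]
      exact (hIco _ hp3).2
  · rw [hpt0, hqt3]
    decide

/-! ### The excluded minors -/

theorem exists_isDoubledUniform {α : Type*} {M : Matroid α}
    (h : IsIsoTo M (uniform 3 7) ∨
      IsIsoTo M (truncationTo 3 ((uniform 1 2).sum (uniform 3 5))) ∨
      IsIsoTo M (truncationTo 3 (((uniform 1 2).sum (uniform 1 2)).sum (uniform 3 3)))) :
    ∃ cls, IsDoubledUniform M cls := by
  rcases h with h | h | h
  · exact isDoubledUniform_uniform.of_isIsoTo h
  · exact isDoubledUniform_truncationTo_sum.of_isIsoTo h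
  · exact isDoubledUniform_truncationTo_sum_sum.of_isIsoTo h

end BicircularLatticePath

theorem mainTheorem4 {α : Type*} (M : Matroid α) (hM : IsLatticePathMatroid M)
    (hr : M.eRank = 3) :
    IsExcludedMinor (fun N : Matroid α => IsBicircularMatroid N ∧ IsLatticePathMatroid N) M ↔
      IsIsoTo M (uniform 3 7) ∨
      IsIsoTo M (truncationTo 3 ((uniform 1 2).sum (uniform 3 5))) ∨
      IsIsoTo M (truncationTo 3 (((uniform 1 2).sum (uniform 1 2)).sum (uniform 3 3))) := by
  have hcard : ∀ I, M.Indep I → I.ncard ≤ 3 := by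
    intro I hI
    have := hI.encard_le_eRank
    rw [hr] at this
    exact ENat.toNat_le_of_le_natCast this
  constructor
  · rintro ⟨hnot, hminor⟩
    rcases hM.isBicircularMatroid_or_exists_isIsoTo fun B hB => hcard B hB.indep with
      hbi | ⟨S, hS, hiso⟩
    · exact absurd ⟨hbi, hM⟩ hnot
    · obtain ⟨cls, hcls⟩ := exists_isDoubledUniform hiso
      rcases hS.eq_or_ssubset with rfl | hss
      · rwa [Matroid.restrict_ground_eq_self] at hiso
      · refine absurd (hminor _ ?_).1 hcls.not_isBicircularMatroid
        exact Matroid.isStrictMinor_iff_isMinor_ssubset.2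
          ⟨⟨∅, M.E \ S, by rw [Matroid.contract_empty, Matroid.delete_compl hS]⟩, hss⟩
  · intro hiso
    obtain ⟨cls, hcls⟩ := exists_isDoubledUniform hiso
    refine ⟨fun h => hcls.not_isBicircularMatroid h.1, fun N hN => ?_⟩
    have hNL := hM.of_isMinor hN.isMinor
    refine ⟨?_, hNL⟩
    rcases hNL.isBicircularMatroid_or_exists_isIsoTo fun B hB =>
      hcard B (hB.indep.of_isMinor hN.isMinor) with hbi | ⟨S, hS, hiso'⟩
    · exact hbi
    · obtain ⟨cls', hcls'⟩ := exists_isDoubledUniform hiso'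
      -- a proper minor has fewer than seven elements
      have hfin : M.E.Finite := Set.finite_of_ncard_pos (by rw [hcls.ncard_ground]; norm_num)
      have h1 := Set.ncard_lt_ncard hN.ssubset hfin
      have h2 := Set.ncard_le_ncard hS (hfin.subset hN.ssubset.subset)
      have h3 : S.ncard = 7 := hcls'.ncard_ground
      rw [hcls.ncard_ground] at h1
      omega
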